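/- **Setting.** Let $\mathbb H$ be the real quaternions and $\mathbb H[z]$ the polynomials in a variable $z$ commuting with the coefficients. For $f=\sum_k z^kf_k$ put $f^{e_\ell}(\alpha)=\sum_k\alpha^kf_k$, $f^{e_r}(\alpha)=\sum_k f_k\alpha^k$, $f^\sharp=\sum_k z^k\overline{f_k}$, and let $L_\alpha f=\sum_k\big(\sum_{j\ge 0}\alpha^jf_{k+j+1}\big)z^k$, the unique polynomial with $f=f^{e_\ell}(\alpha)+(z-\alpha)\cdot L_\alpha f$. Write $\alpha\sim\beta$ if $\alpha=h^{-1}\beta h$ for some $h\ne0$. For a finite set $S\subset\mathbb H$ let $P_{S,\ell}$ (resp. $P_{S,r}$) be the monic polynomial with $\{f: f^{e_\ell}|_S=0\}=P_{S,\ell}\,\mathbb H[z]$ (resp. $\{f: f^{e_r}|_S=0\}=\mathbb H[z]\,P_{S,r}$). For non-real $\alpha=x+yI\sim\beta=x+yJ$ ($x\in\mathbb R$, $y>0$, $I^2=J^2=-1$) let $\Pi_{\alpha,\beta}$ be the real plane $\mathrm{span}\{1,I\}$ if $\beta=\alpha$, $\mathrm{span}\{1,I\}^\perp$ if $\beta=\overline\alpha$,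 and $\mathrm{span}\{I+J,\,1-IJ\}$ otherwise. **Assumptions.** Let $\Lambda=\{\alpha_1,\dots,\alpha_n\}$ and $\Omega=\{\beta_1,\dots,\beta_m\}$ be sets of $n$ and $m$ distinct quaternions with $\Omega\cap\mathbb R=\emptyset$ ($\Lambda$ and $\Omega$ need not be disjoint), such that no three of the $n+m$ nodes $\alpha_1,\dots,\alpha_n,\beta_1,\dots,\beta_m$ are equivalent. Let $0\le k\le\min(n,m)$ with $\alpha_s\sim\beta_s$ for $s\le k$, while $\alpha_i$ ($i>k$) is equivalent to no element of $\Omega$ and $\beta_j$ ($j>k$) to no element of $\Lambda$. Let $c_1,\dots,c_n,d_1,\dots,d_m\in\mathbb H$ satisfy $\overline{\alpha_s}(c_s-d_s)=(c_s-d_s)\beta_s$ for $s\le k$, and let $q_1,\dots,q_k\in\mathbb H$ satisfy $\alpha_sq_s-q_s\beta_s=c_s-d_s$. **Notation.** Put $\Lambda_i=\Lambda\setminus\{\alpha_i\}$, $\Omega_j=\Omega\setminus\{\beta_j\}$, $$\widetilde\alpha_s=P_{\Lambda_s,\ell}^{e_\ell}(\alpha_s)^{-1}\alpha_sP_{\Lambda_s,\ell}^{e_\ell}(\alpha_s),\qquad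 \widetilde\beta_s=P_{\Omega_s,r}^{e_r}(\beta_s)\,\beta_s\,P_{\Omega_s,r}^{e_r}(\beta_s)^{-1}.$$ For polynomials $P,Q$ and quaternions $b,d,a,c$ put $$\gamma(P,Q;b,d)=P^{\sharp e_r}(dbd^{-1})\,d\,(P^\sharp P)(b)^{-1}Q^{e_r}(b)^{-1}\ (d\neq0),\qquad \gamma(P,Q;b,0)=0,$$ $$\rho(P,Q;a,c)=P^{e_\ell}(a)^{-1}(Q^\sharp Q)(a)^{-1}c\,Q^{\sharp e_\ell}(c^{-1}ac)\ (c\ne0),\qquad\rho(P,Q;a,0)=0.$$ For $i>k$ let $\widetilde f_{\ell,i}=P_{\Lambda_i,\ell}\,\rho(P_{\Lambda_i,\ell},P_{\Omega,r};\alpha_i,c_i)\,P_{\Omega,r}$; for $j>k$ let $\widetilde f_{r,j}=P_{\Lambda,\ell}\,\gamma(P_{\Lambda,\ell},P_{\Omega_j,r};\beta_j,d_j)\,P_{\Omega_j,r}$; and for $s\le k$, with $\rho_s=\rho(P_{\Lambda_s,\ell},P_{\Omega_s,r};\alpha_s,c_s)$ and $\gamma_s=\gamma(P_{\Lambda_s,\ell},P_{\Omega_s,r};\beta_s,d_s)$,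 let $$\widetilde f_s=P_{\Lambda_s,\ell}\,\rho_s\,P_{\Omega_s,r}+P_{\Lambda,\ell}\,(2\,\mathrm{Im}\,\widetilde\alpha_s)^{-1}(\rho_s-\gamma_s)\,P_{\Omega_s,r}.$$ For $\mu=(\mu_1,\dots,\mu_k)$ and $h\in\mathbb H[z]$ let $$F_{\mu,h}=\sum_{i=k+1}^n\widetilde f_{\ell,i}+\sum_{j=k+1}^m\widetilde f_{r,j}+\sum_{s=1}^k\widetilde f_s+\sum_{s=1}^kP_{\Lambda_s,\ell}\,\mu_s\,P_{\Omega,r}+P_{\Lambda,\ell}\,h\,P_{\Omega,r}.$$ **Theorem.** For $s\le k$ let $$\mu_s=\gamma\big(L_{\alpha_s}P_{\Lambda,\ell},\,P_{\Omega_s,r};\,\beta_s,\,\widetilde q_s\big),\qquad \widetilde q_s=q_s-(L_{\alpha_s}\widetilde f_s)^{e_r}(\beta_s).$$ Then $\mu_s\in\Pi_{\widetilde\alpha_s,\widetilde\beta_s}$, and $\mu_s$ is the only $\nu\in\Pi_{\widetilde\alpha_s,\widetilde\beta_s}$ with $\big(L_{\alpha_s}(\widetilde f_s+P_{\Lambda,\ell}\,\nu\,P_{\Omega_s,r})\big)^{e_r}(\beta_s)=q_s$.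 A polynomial $f\in\mathbb H[z]$ satisfies $$f^{e_\ell}(\alpha_i)=c_i\ (i\le n),\qquad f^{e_r}(\beta_j)=d_j\ (j\le m),\qquad (L_{\alpha_s}f)^{e_r}(\beta_s)=q_s\ (s\le k)$$ if and only if $f=F_{\mu,h}$ for some $h\in\mathbb H[z]$, and this $h$ is then unique. Moreover, if $\nu_s\in\Pi_{\widetilde\alpha_s,\widetilde\beta_s}$ for all $s\le k$ and $F_{\nu,h}$ satisfies the last group of conditions for some $h$, then $\nu=\mu$. -/

import Mathlib

open scoped Quaternion Polynomial

noncomputable section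

namespace QuatInterp

/-- Left evaluation `∑ αᵏ fₖ` of `f = ∑ zᵏ fₖ`. -/
def leftEval (a : ℍ[ℝ]) (f : ℍ[ℝ][X]) : ℍ[ℝ] :=
  f.sum fun k x => a ^ k * x

/-- Right evaluation `∑ fₖ αᵏ` of `f = ∑ zᵏ fₖ`. -/
def rightEval (a : ℍ[ℝ]) (f : ℍ[ℝ][X]) : ℍ[ℝ] :=
  f.sum fun k x => x * a ^ k

/-- The conjugate polynomial: each coefficient is replaced by its quaternion conjugate. -/
def conjPoly (f : ℍ[ℝ][X]) : ℍ[ℝ][X] :=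
  f.sum fun k x => Polynomial.monomial k (star x)

/-- The left backward shift `L_α`:
`∑_{k ≤ n} zᵏ fₖ ↦ ∑_{k < n} (∑_{j ≤ n-k-1} αʲ f_{k+j+1}) zᵏ`. -/
def leftShift (a : ℍ[ℝ]) (f : ℍ[ℝ][X]) : ℍ[ℝ][X] :=
  ∑ k ∈ Finset.range f.natDegree, Polynomial.monomial k
    (∑ j ∈ Finset.range (f.natDegree - k), a ^ j * f.coeff (k + j + 1))

/-- `P` is the left minimal polynomial of `S`: the monic generator of the right ideal of all
polynomials with left zeros at every point of `S`. -/
def IsLeftMin (S : Set ℍ[ℝ]) (P : ℍ[ℝ][X]) : Prop :=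
  P.Monic ∧ ∀ f : ℍ[ℝ][X], (∀ a ∈ S, leftEval a f = 0) ↔ ∃ g, f = P * g

/-- `P` is the right minimal polynomial of `S`: the monic generator of the left ideal of all
polynomials with right zeros at every point of `S`. -/
def IsRightMin (S : Set ℍ[ℝ]) (P : ℍ[ℝ][X]) : Prop :=
  P.Monic ∧ ∀ f : ℍ[ℝ][X], (∀ a ∈ S, rightEval a f = 0) ↔ ∃ g, f = g * P

theorem leftEval_add (a : ℍ[ℝ]) (f g : ℍ[ℝ][X]) :
    leftEval a (f + g) = leftEval a f + leftEval a g := by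
  unfold leftEval
  exact Polynomial.sum_add_index f g _ (by simp) (by intros; rw [mul_add])

theorem leftEval_mul_monomial (a : ℍ[ℝ]) (P : ℍ[ℝ][X]) (k : ℕ) (x : ℍ[ℝ]) :
    leftEval a (P * Polynomial.monomial k x) = a ^ k * leftEval a P * x := by
  induction P using Polynomial.induction_on' with
  | add p q hp hq => rw [add_mul, leftEval_add, hp, hq, leftEval_add]; noncomm_ring
  | monomial n b =>
    rw [Polynomial.monomial_mul_monomial]
    unfold leftEval
    rw [Polynomial.sum_monomial_index _ _ (by simp), Polynomial.sum_monomial_index _ _ (by simp),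
      add_comm n k, pow_add]
    simp only [mul_assoc]

theorem rightEval_add (a : ℍ[ℝ]) (f g : ℍ[ℝ][X]) :
    rightEval a (f + g) = rightEval a f + rightEval a g := by
  unfold rightEval
  exact Polynomial.sum_add_index f g _ (by simp) (by intros; rw [add_mul])

theorem rightEval_monomial_mul (a : ℍ[ℝ]) (P : ℍ[ℝ][X]) (k : ℕ) (x : ℍ[ℝ]) :
    rightEval a (Polynomial.monomial k x * P) = x * rightEval a P * a ^ k := by
  induction P using Polynomial.induction_on' with
  | add p q hp hq => rw [mul_add, rightEval_add, hp, hq, rightEval_add]; noncomm_ring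
  | monomial n b =>
    rw [Polynomial.monomial_mul_monomial]
    unfold rightEval
    rw [Polynomial.sum_monomial_index _ _ (by simp), Polynomial.sum_monomial_index _ _ (by simp),
      add_comm k n, pow_add]
    simp only [mul_assoc]

/-- Left evaluation of a product. -/
theorem leftEval_mul (a b : ℍ[ℝ]) (P g : ℍ[ℝ][X]) (h : a * leftEval a P = leftEval a P * b) :
    leftEval a (P * g) = leftEval a P * leftEval b g := by
  induction g using Polynomial.induction_on' with
  | add p q hp hq => rw [mul_add, leftEval_add, hp, hq, leftEval_add, mul_add]
  | monomial k x =>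
    have hk : a ^ k * leftEval a P = leftEval a P * b ^ k :=
      (SemiconjBy.pow_right (show SemiconjBy (leftEval a P) b a from h.symm) k).eq.symm
    rw [leftEval_mul_monomial, hk]
    conv_rhs => unfold leftEval
    rw [Polynomial.sum_monomial_index _ _ (by simp), mul_assoc]
    rfl

/-- Right evaluation of a product. -/
theorem rightEval_mul (a b : ℍ[ℝ]) (g P : ℍ[ℝ][X]) (h : rightEval a P * a = b * rightEval a P) :
    rightEval a (g * P) = rightEval b g * rightEval a P := by
  induction g using Polynomial.induction_on' with
  | add p q hp hq => rw [add_mul, rightEval_add, hp, hq, rightEval_add, add_mul]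
  | monomial k x =>
    have hk : rightEval a P * a ^ k = b ^ k * rightEval a P :=
      (SemiconjBy.pow_right (show SemiconjBy (rightEval a P) a b from h) k).eq
    rw [rightEval_monomial_mul, mul_assoc, hk]
    conv_rhs => unfold rightEval
    rw [Polynomial.sum_monomial_index _ _ (by simp), mul_assoc]
    rfl

theorem leftEval_eq_zero_iff (a : ℍ[ℝ]) (f : ℍ[ℝ][X]) :
    leftEval a f = 0 ↔ ∃ g, f = (Polynomial.X - Polynomial.C a) * g := by
  have hX : leftEval a (Polynomial.X - Polynomial.C a) = 0 := by
    have h := leftEval_add a (Polynomial.X - Polynomial.C a) (Polynomial.C a)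
    rw [sub_add_cancel] at h
    simp only [leftEval, Polynomial.sum_X_index, Polynomial.sum_C_index, mul_zero,
      pow_one, mul_one, pow_zero, one_mul] at h ⊢
    exact right_eq_add.mp h
  constructor
  · intro h
    have hd : ∀ f : ℍ[ℝ][X], ∃ g r, f = (Polynomial.X - Polynomial.C a) * g + Polynomial.C r := by
      intro f
      induction f using Polynomial.induction_on' with
      | add p q hp hq =>
        obtain ⟨g, r, rfl⟩ := hp
        obtain ⟨g', r', rfl⟩ := hq
        exact ⟨g + g', r + r', by rw [mul_add, map_add]; abel⟩
      | monomial k x =>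
        induction k with
        | zero => exact ⟨0, x, by simp⟩
        | succ k ih =>
          obtain ⟨g, r, hg⟩ := ih
          refine ⟨g * Polynomial.X + Polynomial.C r, a * r, ?_⟩
          rw [← Polynomial.monomial_mul_X, hg, add_mul, mul_add, ← mul_assoc, sub_mul _ _ (Polynomial.C r),
            map_mul, ← Polynomial.X_mul_C]
          abel
    obtain ⟨g, r, hg⟩ := hd f
    rw [hg, leftEval_add, leftEval_mul a a _ _ (by rw [hX]; simp), hX, zero_mul, zero_add] at h
    have : r = 0 := by simpa [leftEval] using h
    exact ⟨g, by rw [hg, this]; simp⟩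
  · rintro ⟨g, rfl⟩
    rw [leftEval_mul a a _ _ (by rw [hX]; simp), hX, zero_mul]

theorem rightEval_eq_zero_iff (a : ℍ[ℝ]) (f : ℍ[ℝ][X]) :
    rightEval a f = 0 ↔ ∃ g, f = g * (Polynomial.X - Polynomial.C a) := by
  have hX : rightEval a (Polynomial.X - Polynomial.C a) = 0 := by
    have h := rightEval_add a (Polynomial.X - Polynomial.C a) (Polynomial.C a)
    rw [sub_add_cancel] at h
    simp only [rightEval, Polynomial.sum_X_index, Polynomial.sum_C_index, zero_mul,
      pow_one, mul_one, pow_zero, one_mul] at h ⊢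
    exact right_eq_add.mp h
  constructor
  · intro h
    have hd : ∀ f : ℍ[ℝ][X], ∃ g r, f = g * (Polynomial.X - Polynomial.C a) + Polynomial.C r := by
      intro f
      induction f using Polynomial.induction_on' with
      | add p q hp hq =>
        obtain ⟨g, r, rfl⟩ := hp
        obtain ⟨g', r', rfl⟩ := hq
        exact ⟨g + g', r + r', by rw [add_mul, map_add]; abel⟩
      | monomial k x =>
        induction k with
        | zero => exact ⟨0, x, by simp⟩
        | succ k ih =>
          obtain ⟨g, r, hg⟩ := ih
          refine ⟨Polynomial.X * g + Polynomial.C r, r * a, ?_⟩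
          rw [← Polynomial.X_mul_monomial, hg, mul_add, add_mul, mul_assoc, mul_sub,
            mul_sub (Polynomial.C r), map_mul, Polynomial.X_mul_C]
          noncomm_ring
    obtain ⟨g, r, hg⟩ := hd f
    rw [hg, rightEval_add, rightEval_mul a a _ _ (by rw [hX]; simp), hX, mul_zero, zero_add] at h
    have : r = 0 := by simpa [rightEval] using h
    exact ⟨g, by rw [hg, this]; simp⟩
  · rintro ⟨g, rfl⟩
    rw [rightEval_mul a a _ _ (by rw [hX]; simp), hX, mul_zero]

/-- Every finite set has a left minimal polynomial. -/
theorem exists_isLeftMin {S : Set ℍ[ℝ]} (hS : S.Finite) : ∃ P, IsLeftMin S P := by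
  induction S, hS using Set.Finite.induction_on with
  | empty => exact ⟨1, Polynomial.monic_one, fun f => by simp⟩
  | @insert a S _ _ ih =>
    obtain ⟨P, hP, hf⟩ := ih
    by_cases h0 : leftEval a P = 0
    · refine ⟨P, hP, fun f => ?_⟩
      rw [Set.forall_mem_insert, hf]
      refine ⟨fun h => h.2, fun h => ⟨?_, h⟩⟩
      obtain ⟨g, rfl⟩ := h
      rw [leftEval_mul a a _ _ (by rw [h0]; simp), h0, zero_mul]
    · set p := leftEval a P with hp
      have hc : a * leftEval a P = leftEval a P * (p⁻¹ * a * p) := by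
        rw [← hp, mul_assoc, mul_inv_cancel_left₀ h0]
      refine ⟨P * (Polynomial.X - Polynomial.C (p⁻¹ * a * p)),
        hP.mul (Polynomial.monic_X_sub_C _), fun f => ?_⟩
      rw [Set.forall_mem_insert, hf]
      constructor
      · rintro ⟨h1, g, rfl⟩
        rw [leftEval_mul a _ _ _ hc, mul_eq_zero, or_iff_right h0, leftEval_eq_zero_iff] at h1
        obtain ⟨g', rfl⟩ := h1
        exact ⟨g', (mul_assoc _ _ _).symm⟩
      · rintro ⟨g, rfl⟩
        refine ⟨?_, _, mul_assoc _ _ _⟩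
        rw [mul_assoc, leftEval_mul a _ _ _ hc, (leftEval_eq_zero_iff _ _).2 ⟨g, rfl⟩, mul_zero]

/-- Every finite set has a right minimal polynomial. -/
theorem exists_isRightMin {S : Set ℍ[ℝ]} (hS : S.Finite) : ∃ P, IsRightMin S P := by
  induction S, hS using Set.Finite.induction_on with
  | empty => exact ⟨1, Polynomial.monic_one, fun f => by simp⟩
  | @insert a S _ _ ih =>
    obtain ⟨P, hP, hf⟩ := ih
    by_cases h0 : rightEval a P = 0
    · refine ⟨P, hP, fun f => ?_⟩
      rw [Set.forall_mem_insert, hf]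
      refine ⟨fun h => h.2, fun h => ⟨?_, h⟩⟩
      obtain ⟨g, rfl⟩ := h
      rw [rightEval_mul a a _ _ (by rw [h0]; simp), h0, mul_zero]
    · set p := rightEval a P with hp
      have hc : rightEval a P * a = (p * a * p⁻¹) * rightEval a P := by
        rw [← hp, inv_mul_cancel_right₀ h0]
      refine ⟨(Polynomial.X - Polynomial.C (p * a * p⁻¹)) * P,
        (Polynomial.monic_X_sub_C _).mul hP, fun f => ?_⟩
      rw [Set.forall_mem_insert, hf]
      constructor
      · rintro ⟨h1, g, rfl⟩
        rw [rightEval_mul a _ _ _ hc, mul_eq_zero, or_iff_left h0, rightEval_eq_zero_iff] at h1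
        obtain ⟨g', rfl⟩ := h1
        exact ⟨g', by rw [mul_assoc]⟩
      · rintro ⟨g, rfl⟩
        refine ⟨?_, _, (mul_assoc _ _ _).symm⟩
        rw [← mul_assoc, rightEval_mul a _ _ _ hc, (rightEval_eq_zero_iff _ _).2 ⟨g, rfl⟩, zero_mul]

theorem IsLeftMin.unique {S : Set ℍ[ℝ]} {P Q : ℍ[ℝ][X]} (hP : IsLeftMin S P)
    (hQ : IsLeftMin S Q) : P = Q := by
  obtain ⟨g, hg⟩ := (hQ.2 P).1 ((hP.2 P).2 ⟨1, (mul_one P).symm⟩)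
  obtain ⟨g', hg'⟩ := (hP.2 Q).1 ((hQ.2 Q).2 ⟨1, (mul_one Q).symm⟩)
  have hgm : g.Monic := hQ.1.of_mul_monic_left (hg ▸ hP.1)
  have hgm' : g'.Monic := hP.1.of_mul_monic_left (hg' ▸ hQ.1)
  have h1 := hQ.1.natDegree_mul hgm
  have h2 := hP.1.natDegree_mul hgm'
  rw [← hg] at h1
  rw [← hg'] at h2
  have h3 : g = 1 := Polynomial.eq_one_of_monic_natDegree_zero hgm (by omega)
  rw [hg, h3, mul_one]

theorem IsRightMin.unique {S : Set ℍ[ℝ]} {P Q : ℍ[ℝ][X]} (hP : IsRightMin S P)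
    (hQ : IsRightMin S Q) : P = Q := by
  obtain ⟨g, hg⟩ := (hQ.2 P).1 ((hP.2 P).2 ⟨1, (one_mul P).symm⟩)
  obtain ⟨g', hg'⟩ := (hP.2 Q).1 ((hQ.2 Q).2 ⟨1, (one_mul Q).symm⟩)
  have hgm : g.Monic := hQ.1.of_mul_monic_right (hg ▸ hP.1)
  have hgm' : g'.Monic := hP.1.of_mul_monic_right (hg' ▸ hQ.1)
  have h1 := hgm.natDegree_mul hQ.1
  have h2 := hgm'.natDegree_mul hP.1
  rw [← hg] at h1
  rw [← hg'] at h2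
  have h3 : g = 1 := Polynomial.eq_one_of_monic_natDegree_zero hgm (by omega)
  rw [hg, h3, one_mul]

open Classical in
/-- The left minimal polynomial `P_{S,ℓ}` of a set `S` (it exists for every finite `S`). -/
def leftMin (S : Set ℍ[ℝ]) : ℍ[ℝ][X] :=
  if h : ∃ P, IsLeftMin S P then h.choose else 0

open Classical in
/-- The right minimal polynomial `P_{S,r}` of a set `S` (it exists for every finite `S`). -/
def rightMin (S : Set ℍ[ℝ]) : ℍ[ℝ][X] :=
  if h : ∃ P, IsRightMin S P then h.choose else 0

theorem isLeftMin_leftMin {S : Set ℍ[ℝ]} (hS : S.Finite) : IsLeftMin S (leftMin S) := by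
  have h := exists_isLeftMin hS
  rw [leftMin, dif_pos h]
  exact h.choose_spec

theorem isRightMin_rightMin {S : Set ℍ[ℝ]} (hS : S.Finite) : IsRightMin S (rightMin S) := by
  have h := exists_isRightMin hS
  rw [rightMin, dif_pos h]
  exact h.choose_spec

/-- The imaginary unit `I` in the representation `α = x + y I` with `x` real and `y > 0`
of a non-real quaternion. -/
def unitIm (a : ℍ[ℝ]) : ℍ[ℝ] := (‖a.im‖)⁻¹ • a.im

open Classical in
/-- The plane `Π_{α,β}` of two equivalent non-real quaternions `α = x + y I`, `β = x + y J`: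
`span {1, I}` if `β = α`, its orthogonal complement if `β` is the conjugate of `α`, and
`span {I + J, 1 - I J}` otherwise. -/
def plane (a b : ℍ[ℝ]) : Submodule ℝ ℍ[ℝ] :=
  if b = a then Submodule.span ℝ {1, unitIm a}
  else if b = star a then (Submodule.span ℝ {1, unitIm a})ᗮ
  else Submodule.span ℝ {unitIm a + unitIm b, 1 - unitIm a * unitIm b}

open Classical in
/-- `P♯ʳ(d b d⁻¹) · d · (P♯P)(b)⁻¹ · Qʳ(b)⁻¹` if `d ≠ 0`, and `0` if `d = 0`. -/
def gammaCoeff (P Q : ℍ[ℝ][X]) (b d : ℍ[ℝ]) : ℍ[ℝ] :=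
  if d = 0 then 0
  else rightEval (d * b * d⁻¹) (conjPoly P) * d * (rightEval b (conjPoly P * P))⁻¹ *
    (rightEval b Q)⁻¹

open Classical in
/-- `Pˡ(a)⁻¹ · (Q♯Q)(a)⁻¹ · c · Q♯ˡ(c⁻¹ a c)` if `c ≠ 0`, and `0` if `c = 0`. -/
def rhoCoeff (P Q : ℍ[ℝ][X]) (a c : ℍ[ℝ]) : ℍ[ℝ] :=
  if c = 0 then 0
  else (leftEval a P)⁻¹ * (leftEval a (conjPoly Q * Q))⁻¹ * c *
    leftEval (c⁻¹ * a * c) (conjPoly Q)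

section Nodes

variable {n m : ℕ} (α : Fin n → ℍ[ℝ]) (β : Fin m → ℍ[ℝ])

/-- `P_{Λ,ℓ}` for `Λ = {α₁, …, αₙ}`. -/
def PL : ℍ[ℝ][X] := leftMin (Set.range α)

/-- `P_{Λᵢ,ℓ}` for `Λᵢ = Λ \ {αᵢ}`. -/
def PLi (i : Fin n) : ℍ[ℝ][X] := leftMin (Set.range α \ {α i})

/-- `P_{Ω,r}` for `Ω = {β₁, …, βₘ}`. -/
def PR : ℍ[ℝ][X] := rightMin (Set.range β)

/-- `P_{Ωⱼ,r}` for `Ωⱼ = Ω \ {βⱼ}`. -/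
def PRj (j : Fin m) : ℍ[ℝ][X] := rightMin (Set.range β \ {β j})

/-- `α̃ᵢ = P_{Λᵢ,ℓ}(αᵢ)⁻¹ αᵢ P_{Λᵢ,ℓ}(αᵢ)` (left evaluation). -/
def alphaTilde (i : Fin n) : ℍ[ℝ] :=
  (leftEval (α i) (PLi α i))⁻¹ * α i * leftEval (α i) (PLi α i)

/-- `β̃ⱼ = P_{Ωⱼ,r}(βⱼ) βⱼ P_{Ωⱼ,r}(βⱼ)⁻¹` (right evaluation). -/
def betaTilde (j : Fin m) : ℍ[ℝ] :=
  rightEval (β j) (PRj β j) * β j * (rightEval (β j) (PRj β j))⁻¹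

/-- `f̃_{r,j} = P_{Λ,ℓ} γⱼ P_{Ωⱼ,r}`, used when `βⱼ` has no equivalent left node. -/
def fRight (d : Fin m → ℍ[ℝ]) (j : Fin m) : ℍ[ℝ][X] :=
  PL α * Polynomial.C (gammaCoeff (PL α) (PRj β j) (β j) (d j)) * PRj β j

/-- `f̃_{ℓ,i} = P_{Λᵢ,ℓ} ρᵢ P_{Ω,r}`, used when `αᵢ` has no equivalent right node. -/
def fLeft (c : Fin n → ℍ[ℝ]) (i : Fin n) : ℍ[ℝ][X] :=
  PLi α i * Polynomial.C (rhoCoeff (PLi α i) (PR β) (α i) (c i)) * PR β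

/-- `f̃ₛ = P_{Λₛ,ℓ} ρₛ P_{Ωₛ,r} + P_{Λ,ℓ} (2 Im α̃ₛ)⁻¹ (ρₛ - γₛ) P_{Ωₛ,r}` for an equivalent
pair of nodes `(αᵢ, βⱼ)`. -/
def fPair (c : Fin n → ℍ[ℝ]) (d : Fin m → ℍ[ℝ]) (i : Fin n) (j : Fin m) : ℍ[ℝ][X] :=
  PLi α i * Polynomial.C (rhoCoeff (PLi α i) (PRj β j) (α i) (c i)) * PRj β j +
    PL α * Polynomial.C ((2 * (alphaTilde α i).im)⁻¹ *
      (rhoCoeff (PLi α i) (PRj β j) (α i) (c i) - gammaCoeff (PLi α i) (PRj β j) (β j) (d j))) *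
      PRj β j

/-- The value of the parameter `μₛ` of the equivalent pair `(αᵢ, βⱼ)` that is prescribed by the
value `q` of `(L_{αᵢ} f)ʳ(βⱼ)`: with `A = L_{αᵢ} P_{Λ,ℓ}` and `q̃ = q - (L_{αᵢ} f̃ₛ)ʳ(βⱼ)`, it is
`A♯ʳ(q̃ βⱼ q̃⁻¹) q̃ (A♯A)(βⱼ)⁻¹ P_{Ωⱼ,r}(βⱼ)⁻¹` if `q̃ ≠ 0`, and `0` if `q̃ = 0`. -/
def muOf (c : Fin n → ℍ[ℝ]) (d : Fin m → ℍ[ℝ]) (i : Fin n) (j : Fin m) (q : ℍ[ℝ]) : ℍ[ℝ] :=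
  gammaCoeff (leftShift (α i) (PL α)) (PRj β j) (β j)
    (q - rightEval (β j) (leftShift (α i) (fPair α β c d i j)))

/-- The polynomial
`∑_{i>k} f̃_{ℓ,i} + ∑_{j>k} f̃_{r,j} + ∑_{s≤k} f̃ₛ + ∑_{s≤k} P_{Λₛ,ℓ} μₛ P_{Ω,r} + P_{Λ,ℓ} h P_{Ω,r}`.
-/
def solution {k : ℕ} (hkn : k ≤ n) (hkm : k ≤ m) (c : Fin n → ℍ[ℝ]) (d : Fin m → ℍ[ℝ])
    (μ : Fin k → ℍ[ℝ]) (h : ℍ[ℝ][X]) : ℍ[ℝ][X] :=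
  (∑ i : Fin n with k ≤ i.val, fLeft α β c i) +
  (∑ j : Fin m with k ≤ j.val, fRight α β d j) +
  (∑ s : Fin k, fPair α β c d (s.castLE hkn) (s.castLE hkm)) +
  (∑ s : Fin k, PLi α (s.castLE hkn) * Polynomial.C (μ s) * PR β) +
  PL α * h * PR β

end Nodes

end QuatInterp

end

open QuatInterp

open Polynomial

namespace QuatInterp

/-! Evaluation is not multiplicative, but it is twisted-multiplicative: if `p = leftEval a P ≠ 0`,
the left value of `P * g` at `a` is `p` times the left value of `g` at `p⁻¹ a p`, and symmetrically
on the right. On the "wrong" side one uses the norm polynomial `conjPoly P * P`, which has real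
coefficients, hence is central and evaluates multiplicatively. Where it does not vanish, `P` can be
cancelled. This makes each equation "`P x Q` has a prescribed value at a node" uniquely solvable,
with solution ρ on the left (`leftEval_mul_rhoCoeff_mul`) and γ on the right (`eq_gammaCoeff_iff`).
Since no three nodes are equivalent, all the required values and norms are nonzero, and for unpaired
nodes this is Lagrange interpolation.

For an equivalent pair `(a, b)` the two conditions interact through the Sylvester operator `x ↦ a x
- x b`, because the left value at `a` minus the right value at `b` is this operator applied to the
right value of the shift (`leftEval_sub_rightEval`). The operator is singular for `a ~ b`: its image
lies in `{y | ā y = y b}`, and its kernel is the plane Π (`mem_plane_iff`). Passing to coefficients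
replaces the nodes by their twists α̃, β̃. The pair block needs a solution of `α̃ x - x β̃ = ρ - γ`,
and `star_mul_rhoCoeff_sub_gammaCoeff` transfers the solvability condition from `c - d` to `ρ - γ`,
so that `(2 Im α̃)⁻¹ (ρ - γ)` is a solution.

The remaining freedom is a parameter ν in the kernel. Prescribing the shift at `b` fixes it: `L_a`
of `P_Λ ν P_{Ω_s}` is `(L_a P_Λ) ν P_{Ω_s}`, and `L_a P_Λ` has the same norm polynomial as `P_{Λ_s}`
(`norm_leftShift`), which does not vanish at `b`. The same cancellation shows that every solution of
the homogeneous problem has the form `P_Λ h P_Ω`. -/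

/-! ### Evaluation of sums and products -/

theorem leftEval_zero (a : ℍ[ℝ]) : leftEval a 0 = 0 := by simp [leftEval]

theorem rightEval_zero (a : ℍ[ℝ]) : rightEval a 0 = 0 := by simp [rightEval]

theorem leftEval_C (a x : ℍ[ℝ]) : leftEval a (C x) = x := by simp [leftEval]

theorem rightEval_C (a x : ℍ[ℝ]) : rightEval a (C x) = x := by simp [rightEval]

theorem leftEval_X (a : ℍ[ℝ]) : leftEval a X = a := by simp [leftEval]

theorem rightEval_X (a : ℍ[ℝ]) : rightEval a X = a := by simp [rightEval]

theorem leftEval_sub (a : ℍ[ℝ]) (f g : ℍ[ℝ][X]) :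
    leftEval a (f - g) = leftEval a f - leftEval a g := by
  rw [eq_sub_iff_add_eq, ← leftEval_add, sub_add_cancel]

theorem rightEval_sub (a : ℍ[ℝ]) (f g : ℍ[ℝ][X]) :
    rightEval a (f - g) = rightEval a f - rightEval a g := by
  rw [eq_sub_iff_add_eq, ← rightEval_add, sub_add_cancel]

theorem leftEval_sum {ι : Type*} (a : ℍ[ℝ]) (s : Finset ι) (f : ι → ℍ[ℝ][X]) :
    leftEval a (∑ i ∈ s, f i) = ∑ i ∈ s, leftEval a (f i) :=
  map_sum (AddMonoidHom.mk' (leftEval a) (leftEval_add a)) f s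

theorem rightEval_sum {ι : Type*} (a : ℍ[ℝ]) (s : Finset ι) (f : ι → ℍ[ℝ][X]) :
    rightEval a (∑ i ∈ s, f i) = ∑ i ∈ s, rightEval a (f i) :=
  map_sum (AddMonoidHom.mk' (rightEval a) (rightEval_add a)) f s

theorem leftEval_X_sub_C (a b : ℍ[ℝ]) : leftEval a (X - C b) = a - b := by
  rw [leftEval_sub, leftEval_X, leftEval_C]

theorem rightEval_X_sub_C (a b : ℍ[ℝ]) : rightEval a (X - C b) = a - b := by
  rw [rightEval_sub, rightEval_X, rightEval_C]

/-- The left value of a product depends on the first factor only through its left value. -/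
theorem leftEval_mul_eq (a : ℍ[ℝ]) (P g : ℍ[ℝ][X]) :
    leftEval a (P * g) = leftEval a (C (leftEval a P) * g) := by
  induction g using Polynomial.induction_on' with
  | add p q hp hq => rw [mul_add, mul_add, leftEval_add, leftEval_add, hp, hq]
  | monomial k x => rw [leftEval_mul_monomial, leftEval_mul_monomial, leftEval_C]

/-- The right value of a product depends on the last factor only through its right value. -/
theorem rightEval_mul_eq (a : ℍ[ℝ]) (g P : ℍ[ℝ][X]) :
    rightEval a (g * P) = rightEval a (g * C (rightEval a P)) := by
  induction g using Polynomial.induction_on' with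
  | add p q hp hq => rw [add_mul, add_mul, rightEval_add, rightEval_add, hp, hq]
  | monomial k x => rw [rightEval_monomial_mul, rightEval_monomial_mul, rightEval_C]

theorem leftEval_mul_of_eq_zero {a : ℍ[ℝ]} {P : ℍ[ℝ][X]} (h : leftEval a P = 0) (g : ℍ[ℝ][X]) :
    leftEval a (P * g) = 0 := by
  rw [leftEval_mul_eq, h, C_0, zero_mul, leftEval_zero]

theorem rightEval_mul_of_eq_zero {a : ℍ[ℝ]} {P : ℍ[ℝ][X]} (h : rightEval a P = 0) (g : ℍ[ℝ][X]) :
    rightEval a (g * P) = 0 := by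
  rw [rightEval_mul_eq, h, C_0, mul_zero, rightEval_zero]

theorem leftEval_mul_C (a x : ℍ[ℝ]) (P : ℍ[ℝ][X]) :
    leftEval a (P * C x) = leftEval a P * x := by
  rw [leftEval_mul_eq, ← C_mul, leftEval_C]

theorem rightEval_C_mul (a x : ℍ[ℝ]) (P : ℍ[ℝ][X]) :
    rightEval a (C x * P) = x * rightEval a P := by
  rw [rightEval_mul_eq, ← C_mul, rightEval_C]

theorem leftEval_C_mul_of_commute {a u : ℍ[ℝ]} (h : Commute a u) (g : ℍ[ℝ][X]) :
    leftEval a (C u * g) = u * leftEval a g := by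
  rw [leftEval_mul a a _ _ (by rw [leftEval_C]; exact h), leftEval_C]

theorem rightEval_mul_C_of_commute {a u : ℍ[ℝ]} (h : Commute a u) (g : ℍ[ℝ][X]) :
    rightEval a (g * C u) = rightEval a g * u := by
  rw [rightEval_mul a a _ _ (by rw [rightEval_C]; exact h.symm), rightEval_C]

/-! ### The backward shift as division by `X - C a` -/

theorem C_leftEval_add_mul_leftShift (a : ℍ[ℝ]) (f : ℍ[ℝ][X]) :
    C (leftEval a f) + (X - C a) * leftShift a f = f := by
  -- Valid for every `k`: from the degree on, the truncated subtraction makes the inner range empty.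
  have hco : ∀ k, (leftShift a f).coeff k =
      ∑ j ∈ Finset.range (f.natDegree - k), a ^ j * f.coeff (k + j + 1) := by
    intro k
    simp only [leftShift, finsetSum_coeff, coeff_monomial]
    rw [Finset.sum_ite_eq' (Finset.range f.natDegree) k]
    split_ifs with h
    · rfl
    · rw [Finset.mem_range, not_lt] at h
      rw [Nat.sub_eq_zero_of_le h, Finset.sum_range_zero]
  ext1 k
  rcases k with _ | k
  · rw [coeff_add, coeff_C_zero, sub_mul, coeff_sub, coeff_X_mul_zero, coeff_C_mul, hco, leftEval,
      sum_over_range f (by simp), Finset.sum_range_succ']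
    simp [Finset.mul_sum, pow_succ', mul_assoc]
  · rw [coeff_add, coeff_C_of_ne_zero (Nat.succ_ne_zero k), sub_mul, coeff_sub, coeff_X_mul,
      coeff_C_mul, hco, hco, zero_add]
    rcases lt_or_ge k f.natDegree with h | h
    · obtain ⟨t, ht⟩ := Nat.exists_eq_add_of_lt h
      rw [show f.natDegree - k = t + 1 by omega, show f.natDegree - (k + 1) = t by omega,
        Finset.sum_range_succ']
      simp only [Finset.mul_sum, pow_succ', mul_assoc, pow_zero, one_mul, add_zero]
      rw [add_sub_assoc, add_comm, sub_add, sub_eq_self, sub_eq_zero]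
      refine Finset.sum_congr rfl fun j _ => ?_
      rw [show k + 1 + j + 1 = k + (j + 1) + 1 by ring]
    · rw [Nat.sub_eq_zero_of_le h, Nat.sub_eq_zero_of_le (by omega),
        coeff_eq_zero_of_natDegree_lt (by omega)]
      simp

/-- Uniqueness of division with remainder, by cancelling `X - C a`. All further rules for the shift
follow from it, without coefficients. -/
theorem leftShift_eq {a x : ℍ[ℝ]} {f g : ℍ[ℝ][X]} (h : f = C x + (X - C a) * g) :
    leftShift a f = g := by
  have hx : leftEval a f = x := by
    rw [h, leftEval_add, leftEval_C, leftEval_mul_of_eq_zero (by rw [leftEval_X_sub_C, sub_self]),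
      add_zero]
  have h1 := C_leftEval_add_mul_leftShift a f
  rw [hx] at h1
  conv_rhs at h1 => rw [h]
  exact mul_left_cancel₀ (X_sub_C_ne_zero a) (add_left_cancel h1)

theorem leftShift_add (a : ℍ[ℝ]) (f g : ℍ[ℝ][X]) :
    leftShift a (f + g) = leftShift a f + leftShift a g := by
  refine leftShift_eq (x := leftEval a f + leftEval a g) ?_
  conv_lhs => rw [← C_leftEval_add_mul_leftShift a f, ← C_leftEval_add_mul_leftShift a g]
  rw [C_add, mul_add]
  abel

theorem leftShift_sub (a : ℍ[ℝ]) (f g : ℍ[ℝ][X]) :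
    leftShift a (f - g) = leftShift a f - leftShift a g := by
  rw [eq_sub_iff_add_eq, ← leftShift_add, sub_add_cancel]

theorem leftShift_sum {ι : Type*} (a : ℍ[ℝ]) (s : Finset ι) (f : ι → ℍ[ℝ][X]) :
    leftShift a (∑ i ∈ s, f i) = ∑ i ∈ s, leftShift a (f i) :=
  map_sum (AddMonoidHom.mk' (leftShift a) (leftShift_add a)) f s

theorem X_sub_C_mul_leftShift {a : ℍ[ℝ]} {P : ℍ[ℝ][X]} (h : leftEval a P = 0) :
    (X - C a) * leftShift a P = P := by
  have := C_leftEval_add_mul_leftShift a P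
  rwa [h, C_0, zero_add] at this

theorem leftShift_mul {a : ℍ[ℝ]} {P : ℍ[ℝ][X]} (h : leftEval a P = 0) (g : ℍ[ℝ][X]) :
    leftShift a (P * g) = leftShift a P * g := by
  refine leftShift_eq (x := 0) ?_
  rw [C_0, zero_add, ← mul_assoc, X_sub_C_mul_leftShift h]

/-- The left value at `a` and the right value at `b` differ by an element of the image of the
Sylvester operator `x ↦ a x - x b`. -/
theorem leftEval_sub_rightEval (a b : ℍ[ℝ]) (f : ℍ[ℝ][X]) :
    leftEval a f - rightEval b f =
      a * rightEval b (leftShift a f) - rightEval b (leftShift a f) * b := by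
  conv_lhs => rw [← C_leftEval_add_mul_leftShift a f]
  rw [leftEval_add, rightEval_add, leftEval_C, rightEval_C,
    leftEval_mul_of_eq_zero (by rw [leftEval_X_sub_C, sub_self]), sub_mul, rightEval_sub,
    rightEval_C_mul, X_mul, rightEval_mul b b _ _ (by rw [rightEval_X]), rightEval_X]
  abel

/-! ### Conjugation, real polynomials and norm polynomials -/

theorem coeff_conjPoly (f : ℍ[ℝ][X]) (k : ℕ) : (conjPoly f).coeff k = star (f.coeff k) := by
  rw [conjPoly, sum_def, finsetSum_coeff]
  simp only [coeff_monomial]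
  rw [Finset.sum_ite_eq' f.support k]
  split_ifs with h
  · rfl
  · rw [notMem_support_iff.1 h, star_zero]

theorem conjPoly_conjPoly (f : ℍ[ℝ][X]) : conjPoly (conjPoly f) = f := by
  ext1 k
  rw [coeff_conjPoly, coeff_conjPoly, star_star]

theorem conjPoly_sub (f g : ℍ[ℝ][X]) : conjPoly (f - g) = conjPoly f - conjPoly g := by
  ext1 k
  simp only [coeff_conjPoly, coeff_sub, star_sub]

theorem conjPoly_C (x : ℍ[ℝ]) : conjPoly (C x) = C (star x) := by simp [conjPoly]

theorem conjPoly_X : conjPoly (X : ℍ[ℝ][X]) = X := by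
  rw [conjPoly, sum_X_index (by simp), star_one, monomial_one_one_eq_X]

theorem conjPoly_mul (f g : ℍ[ℝ][X]) : conjPoly (f * g) = conjPoly g * conjPoly f := by
  ext1 k
  rw [coeff_conjPoly, coeff_mul, coeff_mul, star_sum, ← Finset.Nat.sum_antidiagonal_swap]
  simp only [coeff_conjPoly, star_mul, Prod.fst_swap, Prod.snd_swap]

theorem conjPoly_ne_zero {f : ℍ[ℝ][X]} (hf : f ≠ 0) : conjPoly f ≠ 0 := by
  intro h
  apply hf
  rw [← conjPoly_conjPoly f, h]
  simp [conjPoly]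

theorem commute_of_star_eq_self {u : ℍ[ℝ]} (h : star u = u) (x : ℍ[ℝ]) : Commute u x := by
  rw [Quaternion.star_eq_self.1 h]
  exact Quaternion.coe_commutes _ _

/-- Polynomials with real coefficients are central. -/
theorem mul_comm_of_conjPoly_eq {N : ℍ[ℝ][X]} (h : conjPoly N = N) (g : ℍ[ℝ][X]) :
    N * g = g * N := by
  have hs : ∀ k, star (N.coeff k) = N.coeff k := fun k => by rw [← coeff_conjPoly, h]
  ext1 k
  rw [coeff_mul, coeff_mul, ← Finset.Nat.sum_antidiagonal_swap]
  exact Finset.sum_congr rfl fun p _ => commute_of_star_eq_self (hs _) _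

theorem leftEval_eq_rightEval_of_conjPoly_eq {N : ℍ[ℝ][X]} (h : conjPoly N = N) (a : ℍ[ℝ]) :
    leftEval a N = rightEval a N := by
  unfold leftEval rightEval
  rw [sum_def, sum_def]
  refine Finset.sum_congr rfl fun k _ => ?_
  exact (commute_of_star_eq_self (by rw [← coeff_conjPoly, h]) _).eq.symm

theorem commute_leftEval_of_conjPoly_eq {N : ℍ[ℝ][X]} (h : conjPoly N = N) (a : ℍ[ℝ]) :
    Commute a (leftEval a N) := by
  have := leftEval_C_mul_of_commute (Commute.refl a) N
  rw [← mul_comm_of_conjPoly_eq h, leftEval_mul_C] at this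
  exact this.symm

theorem leftEval_mul_of_conjPoly_eq {N : ℍ[ℝ][X]} (h : conjPoly N = N) (a : ℍ[ℝ]) (g : ℍ[ℝ][X]) :
    leftEval a (N * g) = leftEval a N * leftEval a g :=
  leftEval_mul a a N g (commute_leftEval_of_conjPoly_eq h a).eq

theorem rightEval_mul_of_conjPoly_eq {N : ℍ[ℝ][X]} (h : conjPoly N = N) (a : ℍ[ℝ])
    (g : ℍ[ℝ][X]) : rightEval a (g * N) = rightEval a g * rightEval a N := by
  refine rightEval_mul a a g N ?_
  rw [← leftEval_eq_rightEval_of_conjPoly_eq h]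
  exact (commute_leftEval_of_conjPoly_eq h a).symm

theorem conjPoly_conjPoly_mul_self (P : ℍ[ℝ][X]) :
    conjPoly (conjPoly P * P) = conjPoly P * P := by
  rw [conjPoly_mul, conjPoly_conjPoly]

/-- Centrality of `conjPoly P * P` gives `P P♯ P = P♯ P P`, and `P` cancels. -/
theorem mul_conjPoly_self (P : ℍ[ℝ][X]) : P * conjPoly P = conjPoly P * P := by
  rcases eq_or_ne P 0 with rfl | hP
  · simp [conjPoly]
  · apply mul_right_cancel₀ hP
    rw [mul_comm_of_conjPoly_eq (conjPoly_conjPoly_mul_self P), mul_assoc]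

theorem conjPoly_mul_mul_mul (P Q : ℍ[ℝ][X]) :
    conjPoly (P * Q) * (P * Q) = (conjPoly P * P) * (conjPoly Q * Q) := by
  rw [mul_comm_of_conjPoly_eq (conjPoly_conjPoly_mul_self P), conjPoly_mul]
  simp only [mul_assoc]
  rw [← mul_assoc (conjPoly P) P Q, mul_comm_of_conjPoly_eq (conjPoly_conjPoly_mul_self P)]

/-- Multiplying on the right by `conjPoly Q` turns `x Q` into the central norm of `Q` times `x`,
whose left value is the value of the norm times `x`. -/
theorem leftEval_C_mul_cancel {a x : ℍ[ℝ]} {Q : ℍ[ℝ][X]} (hN : leftEval a (conjPoly Q * Q) ≠ 0)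
    (h : leftEval a (C x * Q) = 0) : x = 0 := by
  have h1 := leftEval_mul_of_eq_zero h (conjPoly Q)
  rw [mul_assoc, mul_conjPoly_self, ← mul_comm_of_conjPoly_eq (conjPoly_conjPoly_mul_self Q),
    leftEval_mul_C] at h1
  exact (mul_eq_zero.1 h1).resolve_left hN

theorem rightEval_mul_C_cancel {a x : ℍ[ℝ]} {P : ℍ[ℝ][X]} (hN : rightEval a (conjPoly P * P) ≠ 0)
    (h : rightEval a (P * C x) = 0) : x = 0 := by
  have h1 := rightEval_mul_of_eq_zero h (conjPoly P)
  rw [← mul_assoc, mul_comm_of_conjPoly_eq (conjPoly_conjPoly_mul_self P), rightEval_C_mul] at h1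
  exact (mul_eq_zero.1 h1).resolve_right hN

theorem rightEval_mul_cancel {a : ℍ[ℝ]} {P g : ℍ[ℝ][X]}
    (hN : rightEval a (conjPoly P * P) ≠ 0) (h : rightEval a (P * g) = 0) : rightEval a g = 0 := by
  rw [rightEval_mul_eq] at h
  exact rightEval_mul_C_cancel hN h

/-! ### The coefficients ρ and γ as solutions of one-point problems -/

/-- The product rule absorbs the twisted node `c⁻¹ a c`, giving a formula that is additive in `c`
and free of the case `c = 0`. -/
theorem rhoCoeff_eq (P Q : ℍ[ℝ][X]) (a c : ℍ[ℝ]) : rhoCoeff P Q a c =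
    (leftEval a P)⁻¹ * (leftEval a (conjPoly Q * Q))⁻¹ * leftEval a (C c * conjPoly Q) := by
  unfold rhoCoeff
  split_ifs with h
  · rw [h, C_0, zero_mul, leftEval_zero, mul_zero]
  · rw [leftEval_mul a (c⁻¹ * a * c) (C c) _
      (by rw [leftEval_C, ← mul_assoc, mul_inv_cancel_left₀ h]), leftEval_C, mul_assoc, mul_assoc,
      mul_assoc]

theorem gammaCoeff_eq (P Q : ℍ[ℝ][X]) (b d : ℍ[ℝ]) : gammaCoeff P Q b d =
    rightEval b (conjPoly P * C d) * (rightEval b (conjPoly P * P))⁻¹ * (rightEval b Q)⁻¹ := by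
  unfold gammaCoeff
  split_ifs with h
  · rw [h, C_0, mul_zero, rightEval_zero, zero_mul, zero_mul]
  · rw [rightEval_mul b (d * b * d⁻¹) _ (C d)
      (by rw [rightEval_C, inv_mul_cancel_right₀ h]), rightEval_C]

/-- With `N` the norm polynomial of `Q`, the value `N(a)` commutes with `a`, so its inverse leaves
the evaluation as a left factor. What remains is the value of `c Q♯ Q = N c`, namely `N(a) c`. -/
theorem leftEval_mul_rhoCoeff_mul {P Q : ℍ[ℝ][X]} {a : ℍ[ℝ]} (hP : leftEval a P ≠ 0)
    (hQ : leftEval a (conjPoly Q * Q) ≠ 0) (c : ℍ[ℝ]) :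
    leftEval a (P * C (rhoCoeff P Q a c) * Q) = c := by
  have hN := conjPoly_conjPoly_mul_self Q
  rw [leftEval_mul_eq, leftEval_mul_C, rhoCoeff_eq, mul_assoc (leftEval a P)⁻¹,
    mul_inv_cancel_left₀ hP, C_mul, mul_assoc,
    leftEval_C_mul_of_commute (commute_leftEval_of_conjPoly_eq hN a).inv_right₀,
    ← leftEval_mul_eq, mul_assoc, ← mul_comm_of_conjPoly_eq hN, leftEval_mul_C,
    inv_mul_cancel_left₀ hQ]

theorem rightEval_mul_gammaCoeff_mul {P Q : ℍ[ℝ][X]} {b : ℍ[ℝ]}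
    (hP : rightEval b (conjPoly P * P) ≠ 0) (hQ : rightEval b Q ≠ 0) (d : ℍ[ℝ]) :
    rightEval b (P * C (gammaCoeff P Q b d) * Q) = d := by
  have hN := conjPoly_conjPoly_mul_self P
  have hc := commute_leftEval_of_conjPoly_eq hN b
  rw [leftEval_eq_rightEval_of_conjPoly_eq hN] at hc
  rw [mul_assoc, rightEval_mul_eq, rightEval_C_mul, gammaCoeff_eq, inv_mul_cancel_right₀ hQ, C_mul,
    ← mul_assoc, rightEval_mul_C_of_commute hc.inv_right₀, ← rightEval_mul_eq, ← mul_assoc,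
    mul_conjPoly_self, mul_comm_of_conjPoly_eq hN, rightEval_C_mul, mul_inv_cancel_right₀ hP]

theorem eq_gammaCoeff_iff {P Q : ℍ[ℝ][X]} {b : ℍ[ℝ]}
    (hP : rightEval b (conjPoly P * P) ≠ 0) (hQ : rightEval b Q ≠ 0) (d x : ℍ[ℝ]) :
    rightEval b (P * C x * Q) = d ↔ x = gammaCoeff P Q b d := by
  refine ⟨fun h => ?_, fun h => by rw [h, rightEval_mul_gammaCoeff_mul hP hQ]⟩
  have h1 : rightEval b (P * (C (x - gammaCoeff P Q b d) * Q)) = 0 := by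
    rw [C_sub, sub_mul, mul_sub, rightEval_sub, ← mul_assoc, ← mul_assoc, h,
      rightEval_mul_gammaCoeff_mul hP hQ, sub_self]
  have h2 := rightEval_mul_cancel hP h1
  rw [rightEval_C_mul, mul_eq_zero, or_iff_left hQ, sub_eq_zero] at h2
  exact h2

/-! ### Equivalence of quaternions and the image of the Sylvester operator -/

theorem isConj_of_mul_eq {a b h : ℍ[ℝ]} (h0 : h ≠ 0) (e : h * a = b * h) : IsConj a b :=
  ⟨Units.mk0 h h0, e⟩

theorem exists_mul_eq_of_isConj {a b : ℍ[ℝ]} (h : IsConj a b) :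
    ∃ u : ℍ[ℝ], u ≠ 0 ∧ u * a = b * u := by
  obtain ⟨u, hu⟩ := h
  exact ⟨u, u.ne_zero, hu⟩

theorem isConj_inv_mul_mul (a : ℍ[ℝ]) {p : ℍ[ℝ]} (hp : p ≠ 0) : IsConj (p⁻¹ * a * p) a :=
  isConj_of_mul_eq hp (by rw [mul_assoc, mul_inv_cancel_left₀ hp])

theorem isConj_mul_mul_inv (a : ℍ[ℝ]) {p : ℍ[ℝ]} (hp : p ≠ 0) : IsConj a (p * a * p⁻¹) :=
  isConj_of_mul_eq hp (by rw [inv_mul_cancel_right₀ hp])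

/-- A nonzero imaginary quaternion orthogonal to `a.im` anticommutes with it, hence conjugates `a`
into `star a`. The two cases exhibit one in the span of the last two units. -/
theorem isConj_star (a : ℍ[ℝ]) : IsConj a (star a) := by
  have hex : ∀ y z : ℝ, ∃ u : ℍ[ℝ], u.re = 0 ∧ u.imI = 0 ∧ u.imJ = y ∧ u.imK = z :=
    fun y z => ⟨⟨0, 0, y, z⟩, rfl, rfl, rfl, rfl⟩
  by_cases h : a.imJ = 0 ∧ a.imK = 0
  · obtain ⟨u, h0, h1, h2, h3⟩ := hex 1 0
    refine isConj_of_mul_eq (h := u) (fun hu => ?_) ?_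
    · simp [hu] at h2
    · ext <;> simp [h.1, h.2, h0, h1, h2, h3]
  · obtain ⟨u, h0, h1, h2, h3⟩ := hex a.imK (-a.imJ)
    refine isConj_of_mul_eq (h := u) (fun hu => h ?_) ?_
    · simp [hu] at h2 h3
      exact ⟨h3, h2.symm⟩
    · ext <;> simp [h0, h1, h2, h3] <;> ring

theorem re_eq_of_isConj {a b : ℍ[ℝ]} (h : IsConj a b) : a.re = b.re := by
  obtain ⟨u, hu, e⟩ := exists_mul_eq_of_isConj h
  have hb : b = u * (a * u⁻¹) := by rw [← mul_assoc, e, mul_inv_cancel_right₀ hu]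
  have hre : ∀ x y : ℍ[ℝ], (x * y).re = (y * x).re := fun x y => by simp; ring
  rw [hb, hre, mul_assoc, inv_mul_cancel₀ hu, mul_one]

theorem norm_eq_of_isConj {a b : ℍ[ℝ]} (h : IsConj a b) : ‖a‖ = ‖b‖ := by
  obtain ⟨u, hu, e⟩ := exists_mul_eq_of_isConj h
  have := congrArg norm e
  rw [norm_mul, norm_mul, mul_comm] at this
  exact mul_right_cancel₀ (norm_ne_zero_iff.2 hu) this

theorem norm_im_eq_of_isConj {a b : ℍ[ℝ]} (h : IsConj a b) : ‖a.im‖ = ‖b.im‖ := by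
  have h1 := re_eq_of_isConj h
  have h2 : Quaternion.normSq a = Quaternion.normSq b := by
    rw [Quaternion.normSq_eq_norm_mul_self, Quaternion.normSq_eq_norm_mul_self, norm_eq_of_isConj h]
  rw [Quaternion.normSq_def', Quaternion.normSq_def', h1] at h2
  rw [← sq_eq_sq₀ (norm_nonneg _) (norm_nonneg _), sq, sq, ← Quaternion.normSq_eq_norm_mul_self,
    ← Quaternion.normSq_eq_norm_mul_self, Quaternion.normSq_def', Quaternion.normSq_def']
  simp
  linarith

theorem im_ne_zero_of_isConj {a b : ℍ[ℝ]} (h : IsConj a b) (hb : b.im ≠ 0) : a.im ≠ 0 := by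
  rw [← norm_ne_zero_iff, norm_im_eq_of_isConj h]
  exact norm_ne_zero_iff.2 hb

/-- The image of `x ↦ a x - x b` for equivalent `a`, `b`. -/
theorem star_mul_sub_eq {a b : ℍ[ℝ]} (h : IsConj a b) (x : ℍ[ℝ]) :
    star a * (a * x - x * b) = (a * x - x * b) * b := by
  have hn : star a * a = b * star b := by
    rw [Quaternion.star_mul_self, Quaternion.self_mul_star, Quaternion.normSq_eq_norm_mul_self,
      Quaternion.normSq_eq_norm_mul_self, norm_eq_of_isConj h]
  have hs : star b = (star a + a) - b := by
    rw [Quaternion.star_add_self, re_eq_of_isConj h, ← Quaternion.star_add_self,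
      add_sub_cancel_right]
  have hc : Commute (star a + a) x := commute_of_star_eq_self (by simp [add_comm]) x
  have hc' : Commute (star a + a) b := commute_of_star_eq_self (by simp [add_comm]) b
  have hn' : x * (b * star b) = (star a * a) * x := by
    rw [← hn]
    exact (commute_of_star_eq_self (by simp) x).eq.symm
  -- The quadratic equation of `b`, with its trace written as that of `a`.
  have hbb : b * b = (star a + a) * b - b * star b := by
    rw [hs, mul_sub, hc'.eq]; abel
  calc star a * (a * x - x * b) = (star a * a) * x - star a * x * b := by noncomm_ring
    _ = x * (b * star b) - star a * x * b := by rw [hn']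
    _ = (a * x - x * b) * b := by
        have : x * b * b = (star a + a) * x * b - x * (b * star b) := by
          rw [mul_assoc, hbb, mul_sub, ← mul_assoc, hc.eq]
        rw [sub_mul, this]; noncomm_ring

/-! ### The plane Π as the kernel of the Sylvester operator -/

theorem im_eq_smul_unitIm {a : ℍ[ℝ]} (ha : a.im ≠ 0) : a.im = ‖a.im‖ • unitIm a := by
  rw [unitIm, smul_smul, mul_inv_cancel₀ (norm_ne_zero_iff.2 ha), one_smul]

theorem mul_eq_mul_iff_unitIm {a b : ℍ[ℝ]} (h : IsConj a b) (hb : b.im ≠ 0) (x : ℍ[ℝ]) :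
    a * x = x * b ↔ unitIm a * x = x * unitIm b := by
  have hy := norm_ne_zero_iff.2 hb
  have ha : a = (b.re : ℍ[ℝ]) + ‖b.im‖ • unitIm a := by
    conv_lhs => rw [← a.re_add_im, im_eq_smul_unitIm (im_ne_zero_of_isConj h hb),
      re_eq_of_isConj h, norm_im_eq_of_isConj h]
  have hb' : b = (b.re : ℍ[ℝ]) + ‖b.im‖ • unitIm b := by
    conv_lhs => rw [← b.re_add_im, im_eq_smul_unitIm hb]
  have e1 : a * x = (b.re : ℍ[ℝ]) * x + ‖b.im‖ • (unitIm a * x) := by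
    conv_lhs => rw [ha]
    rw [add_mul, smul_mul_assoc]
  have e2 : x * b = (b.re : ℍ[ℝ]) * x + ‖b.im‖ • (x * unitIm b) := by
    conv_lhs => rw [hb']
    rw [mul_add, mul_smul_comm, (Quaternion.coe_commutes b.re x)]
  rw [e1, e2, add_right_inj]
  exact ⟨fun e => smul_right_injective _ hy e, fun e => by rw [e]⟩

theorem unitIm_re (a : ℍ[ℝ]) : (unitIm a).re = 0 := by simp [unitIm]

theorem unitIm_mul_self {a : ℍ[ℝ]} (ha : a.im ≠ 0) : unitIm a * unitIm a = -1 := by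
  have h1 : unitIm a * star (unitIm a) = 1 := by
    rw [Quaternion.self_mul_star, Quaternion.normSq_eq_norm_mul_self, unitIm, norm_smul, norm_inv,
      norm_norm, inv_mul_cancel₀ (norm_ne_zero_iff.2 ha)]
    simp
  rw [Quaternion.star_eq_neg.2 (unitIm_re a), mul_neg] at h1
  rw [← h1, neg_neg]

/-- A quaternion that commutes with an imaginary unit `u` lies in the plane of `1` and `u`. -/
theorem eq_add_smul_of_commute {u : ℍ[ℝ]} (hu : u * u = -1) (hre : u.re = 0) {x : ℍ[ℝ]}
    (h : u * x = x * u) : ∃ s t : ℝ, x = s • (1 : ℍ[ℝ]) + t • u := by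
  have hn := congrArg QuaternionAlgebra.re hu
  have e1 := congrArg QuaternionAlgebra.imI h
  have e2 := congrArg QuaternionAlgebra.imJ h
  have e3 := congrArg QuaternionAlgebra.imK h
  simp [hre] at hn e1 e2 e3
  -- The second coefficient is the inner product with `u`. Commuting means that the cross product
  -- with `u` vanishes, and the combinations below are the triple product identity with `|u| = 1`.
  refine ⟨x.re, u.imI * x.imI + u.imJ * x.imJ + u.imK * x.imK, ?_⟩
  ext
  · simp [hre]
  · simp; linear_combination x.imI * hn + (u.imK / 2) * e2 - (u.imJ / 2) * e3
  · simp; linear_combination x.imJ * hn + (u.imI / 2) * e3 - (u.imK / 2) * e1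
  · simp; linear_combination x.imK * hn + (u.imJ / 2) * e1 - (u.imI / 2) * e2

theorem mem_orthogonal_iff_anticommute {u : ℍ[ℝ]} (hu : u * u = -1) (hre : u.re = 0) (x : ℍ[ℝ]) :
    x ∈ (Submodule.span ℝ {1, u})ᗮ ↔ u * x = -(x * u) := by
  have hmem : x ∈ (Submodule.span ℝ {1, u})ᗮ ↔ x.re = 0 ∧
      u.imI * x.imI + u.imJ * x.imJ + u.imK * x.imK = 0 := by
    rw [Submodule.mem_orthogonal]
    constructor
    · intro h
      have h1 := h 1 (Submodule.subset_span (by simp))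
      have h2 := h u (Submodule.subset_span (by simp))
      rw [Quaternion.inner_def] at h1 h2
      simp [hre] at h1 h2
      exact ⟨h1, h2⟩
    · rintro ⟨h1, h2⟩ y hy
      obtain ⟨s, t, rfl⟩ := Submodule.mem_span_pair.1 hy
      rw [Quaternion.inner_def]
      simp [hre, h1]
      linear_combination t * h2
  rw [hmem]
  have hn := congrArg QuaternionAlgebra.re hu
  simp [hre] at hn
  constructor
  · rintro ⟨h1, h2⟩
    ext
    · simp [hre, h1]; linear_combination (-2) * h2
    all_goals simp [hre, h1]; ring
  · intro h
    have e0 := congrArg QuaternionAlgebra.re h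
    have e1 := congrArg QuaternionAlgebra.imI h
    have e2 := congrArg QuaternionAlgebra.imJ h
    have e3 := congrArg QuaternionAlgebra.imK h
    simp [hre] at e0 e1 e2 e3
    refine ⟨?_, ?_⟩
    · linear_combination (u.imI / 2) * e1 + (u.imJ / 2) * e2 + (u.imK / 2) * e3 + x.re * hn
    · linear_combination (-1 / 2) * e0

/-- Equivalent nodes share real part and `‖im‖`, so only the units `I`, `J` matter. For `J = I` the
condition is commuting with `I`, for `J = -I` anticommuting. Otherwise `I + J` is a nonzero
intertwiner, and dividing by it on the right reduces to the commuting case. -/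
theorem mem_plane_iff {a b : ℍ[ℝ]} (h : IsConj a b) (hb : b.im ≠ 0) (x : ℍ[ℝ]) :
    x ∈ plane a b ↔ a * x = x * b := by
  have ha := im_ne_zero_of_isConj h hb
  have hI := unitIm_mul_self ha
  have hJ := unitIm_mul_self hb
  rw [mul_eq_mul_iff_unitIm h hb, plane]
  split_ifs with h1 h2
  · subst h1
    rw [Submodule.mem_span_pair]
    constructor
    · rintro ⟨s, t, rfl⟩
      simp [mul_add, add_mul]
    · intro e
      obtain ⟨s, t, hx⟩ := eq_add_smul_of_commute hI (unitIm_re _) e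
      exact ⟨s, t, hx.symm⟩
  · have : unitIm b = -unitIm a := by
      rw [unitIm, unitIm, norm_im_eq_of_isConj h, h2, Quaternion.im_star, smul_neg]
    rw [this, mul_neg]
    exact mem_orthogonal_iff_anticommute hI (unitIm_re a) x
  · have hv : unitIm a + unitIm b ≠ 0 := by
      intro e
      apply h2
      have e' : unitIm b = - unitIm a := eq_neg_of_add_eq_zero_right e
      rw [← b.re_add_im, im_eq_smul_unitIm hb, e', ← re_eq_of_isConj h, ← norm_im_eq_of_isConj h,
        smul_neg, ← im_eq_smul_unitIm ha]
      conv_rhs => rw [← a.re_add_im]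
      ext <;> simp
    set I := unitIm a
    set J := unitIm b
    have hIv : I * (I + J) = (I + J) * J := by
      rw [mul_add, add_mul, hI, hJ, add_comm]
    rw [Submodule.mem_span_pair]
    constructor
    · rintro ⟨s, t, rfl⟩
      have e : I * (1 - I * J) = (1 - I * J) * J := by
        rw [mul_sub, sub_mul, ← mul_assoc, hI, mul_assoc, hJ]; noncomm_ring
      rw [mul_add, add_mul, mul_smul_comm, mul_smul_comm, smul_mul_assoc, smul_mul_assoc, e, hIv]
    · intro e
      have e1 : I * (x * (I + J)⁻¹) = x * (I + J)⁻¹ * I := by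
        apply mul_right_cancel₀ hv
        rw [mul_assoc I, inv_mul_cancel_right₀ hv, e, mul_assoc _ I, hIv, ← mul_assoc,
          inv_mul_cancel_right₀ hv]
      obtain ⟨s, t, hx⟩ := eq_add_smul_of_commute hI (unitIm_re a) e1
      -- The sign comes from `I (I + J) = -(1 - I J)`.
      refine ⟨s, -t, ?_⟩
      rw [← inv_mul_cancel_right₀ hv x, hx, add_mul, smul_mul_assoc, smul_mul_assoc, one_mul,
        mul_add, hI, neg_smul, ← smul_neg, neg_sub, sub_eq_add_neg, add_comm (I * J)]

/-! ### Nonvanishing of minimal polynomials and of their norms -/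

/-- A polynomial `z² - 2 Re(b) z + |b|²` vanishes only on the equivalence class of `b`. -/
theorem isConj_of_leftEval_conjPoly_mul_eq_zero {a b : ℍ[ℝ]}
    (h : leftEval a (conjPoly (X - C b) * (X - C b)) = 0) : IsConj b a := by
  rw [conjPoly_sub, conjPoly_X, conjPoly_C] at h
  by_cases hp : a - star b = 0
  · rw [sub_eq_zero.1 hp]
    exact isConj_star b
  · rw [leftEval_mul a ((a - star b)⁻¹ * a * (a - star b)) _ _
      (by rw [leftEval_X_sub_C, mul_assoc, mul_inv_cancel_left₀ hp]), leftEval_X_sub_C,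
      leftEval_X_sub_C, mul_eq_zero, or_iff_right hp, sub_eq_zero] at h
    rw [mul_assoc] at h
    exact isConj_of_mul_eq hp ((inv_mul_eq_iff_eq_mul₀ hp).1 h).symm

/-- The product of the norms of `X - C b` over `b ∈ S`. Being central, it is a multiple of both
minimal polynomials of `S`, which bounds where these and their norms can vanish. -/
theorem exists_real_vanishing {S : Set ℍ[ℝ]} (hS : S.Finite) : ∃ g : ℍ[ℝ][X],
    conjPoly g = g ∧ (∀ x ∈ S, leftEval x g = 0) ∧
      ∀ a, (∀ x ∈ S, ¬ IsConj x a) → leftEval a g ≠ 0 := by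
  induction S, hS using Set.Finite.induction_on with
  | empty =>
    refine ⟨1, by rw [← C_1, conjPoly_C, star_one], by simp, fun a _ => ?_⟩
    rw [← C_1, leftEval_C]
    exact one_ne_zero
  | @insert b S _ _ ih =>
    obtain ⟨g, hg, h0, h1⟩ := ih
    have hb := conjPoly_conjPoly_mul_self (X - C b)
    refine ⟨g * (conjPoly (X - C b) * (X - C b)), ?_, ?_, ?_⟩
    · rw [conjPoly_mul, hg, hb, mul_comm_of_conjPoly_eq hg]
    · intro x hx
      rcases hx with rfl | hx
      · rw [leftEval_mul_of_conjPoly_eq hg, ← mul_conjPoly_self,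
          leftEval_mul_of_eq_zero (by rw [leftEval_X_sub_C, sub_self]), mul_zero]
      · exact leftEval_mul_of_eq_zero (h0 x hx) _
    · intro a ha
      rw [leftEval_mul_of_conjPoly_eq hg]
      exact mul_ne_zero (h1 a fun x hx => ha x (Set.mem_insert_of_mem _ hx)) fun h =>
        ha b (Set.mem_insert _ _) (isConj_of_leftEval_conjPoly_mul_eq_zero h)

/-- Norms are multiplicative and the norm of a real `g` is `g * g`, so a zero of the norm of a
factor would be a zero of `g`. -/
theorem leftEval_norm_ne_zero_of_mul_right {g P k : ℍ[ℝ][X]} (hg : conjPoly g = g) {a : ℍ[ℝ]}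
    (ha : leftEval a g ≠ 0) (h : g = P * k) : leftEval a (conjPoly P * P) ≠ 0 := by
  intro h0
  have h1 := leftEval_mul_of_eq_zero h0 (conjPoly k * k)
  rw [← conjPoly_mul_mul_mul, ← h, hg, leftEval_mul_of_conjPoly_eq hg] at h1
  exact ha (mul_self_eq_zero.1 h1)

theorem leftEval_norm_ne_zero_of_mul_left {g P k : ℍ[ℝ][X]} (hg : conjPoly g = g) {a : ℍ[ℝ]}
    (ha : leftEval a g ≠ 0) (h : g = k * P) : leftEval a (conjPoly P * P) ≠ 0 := by
  intro h0
  have h1 := leftEval_mul_of_eq_zero h0 (conjPoly k * k)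
  rw [mul_comm_of_conjPoly_eq (conjPoly_conjPoly_mul_self P), ← conjPoly_mul_mul_mul, ← h, hg,
    leftEval_mul_of_conjPoly_eq hg] at h1
  exact ha (mul_self_eq_zero.1 h1)

theorem IsLeftMin.norm_ne_zero {S : Set ℍ[ℝ]} {P : ℍ[ℝ][X]} (h : IsLeftMin S P) (hS : S.Finite)
    {a : ℍ[ℝ]} (ha : ∀ x ∈ S, ¬ IsConj x a) : leftEval a (conjPoly P * P) ≠ 0 := by
  obtain ⟨g, hg, h0, h1⟩ := exists_real_vanishing hS
  obtain ⟨k, hk⟩ := (h.2 g).1 h0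
  exact leftEval_norm_ne_zero_of_mul_right hg (h1 a ha) hk

theorem IsRightMin.norm_ne_zero {S : Set ℍ[ℝ]} {P : ℍ[ℝ][X]} (h : IsRightMin S P) (hS : S.Finite)
    {a : ℍ[ℝ]} (ha : ∀ x ∈ S, ¬ IsConj x a) : leftEval a (conjPoly P * P) ≠ 0 := by
  obtain ⟨g, hg, h0, h1⟩ := exists_real_vanishing hS
  obtain ⟨k, hk⟩ := (h.2 g).1 fun x hx => by
    rw [← leftEval_eq_rightEval_of_conjPoly_eq hg, h0 x hx]
  exact leftEval_norm_ne_zero_of_mul_left hg (h1 a ha) hk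

/-- The left minimal polynomial of `S` has no zero at a point outside `S` that is equivalent to
at most one point of `S`. -/
theorem IsLeftMin.leftEval_ne_zero {S : Set ℍ[ℝ]} {P : ℍ[ℝ][X]} (h : IsLeftMin S P)
    (hS : S.Finite) {a b : ℍ[ℝ]} (hab : a ≠ b) (ha : ∀ x ∈ S, x ≠ b → ¬ IsConj x a) :
    leftEval a P ≠ 0 := by
  intro hP
  obtain ⟨g, hg, h0, h1⟩ := exists_real_vanishing (hS.subset (Set.sdiff_subset (t := {b})))
  -- The test polynomial vanishes on `S`, hence is a multiple of `P`, but since `g` is real its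
  -- value at `a` is `g(a) (a - b) ≠ 0`.
  obtain ⟨k, hk⟩ := (h.2 (g * (X - C b))).1 fun x hx => by
    by_cases hxb : x = b
    · rw [leftEval_mul_of_conjPoly_eq hg, leftEval_X_sub_C, hxb, sub_self, mul_zero]
    · exact leftEval_mul_of_eq_zero (h0 x ⟨hx, hxb⟩) _
  have h2 : leftEval a (g * (X - C b)) = 0 := by rw [hk, leftEval_mul_of_eq_zero hP]
  rw [leftEval_mul_of_conjPoly_eq hg, leftEval_X_sub_C] at h2
  exact mul_ne_zero (h1 a fun x hx => ha x hx.1 hx.2) (sub_ne_zero.2 hab) h2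

/-- The right minimal polynomial of `S` has no zero at a point outside `S` that is equivalent to
at most one point of `S`. -/
theorem IsRightMin.rightEval_ne_zero {S : Set ℍ[ℝ]} {P : ℍ[ℝ][X]} (h : IsRightMin S P)
    (hS : S.Finite) {a b : ℍ[ℝ]} (hab : a ≠ b) (ha : ∀ x ∈ S, x ≠ b → ¬ IsConj x a) :
    rightEval a P ≠ 0 := by
  intro hP
  obtain ⟨g, hg, h0, h1⟩ := exists_real_vanishing (hS.subset (Set.sdiff_subset (t := {b})))
  obtain ⟨k, hk⟩ := (h.2 ((X - C b) * g)).1 fun x hx => by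
    by_cases hxb : x = b
    · rw [rightEval_mul_of_conjPoly_eq hg, rightEval_X_sub_C, hxb, sub_self, zero_mul]
    · exact rightEval_mul_of_eq_zero
        (by rw [← leftEval_eq_rightEval_of_conjPoly_eq hg, h0 x ⟨hx, hxb⟩]) _
  have h2 : rightEval a ((X - C b) * g) = 0 := by rw [hk, rightEval_mul_of_eq_zero hP]
  rw [rightEval_mul_of_conjPoly_eq hg, rightEval_X_sub_C,
    ← leftEval_eq_rightEval_of_conjPoly_eq hg] at h2
  exact mul_ne_zero (sub_ne_zero.2 hab) (h1 a fun x hx => ha x hx.1 hx.2) h2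

/-- By the product rule, `P * g` has a left zero at `a` exactly when `g` has one at the twisted
node. -/
theorem IsLeftMin.insert {S : Set ℍ[ℝ]} {P : ℍ[ℝ][X]} (h : IsLeftMin S P) {a : ℍ[ℝ]}
    (ha : leftEval a P ≠ 0) :
    IsLeftMin (insert a S) (P * (X - C ((leftEval a P)⁻¹ * a * leftEval a P))) := by
  have hc : a * leftEval a P = leftEval a P * ((leftEval a P)⁻¹ * a * leftEval a P) := by
    rw [mul_assoc, mul_inv_cancel_left₀ ha]
  refine ⟨h.1.mul (monic_X_sub_C _), fun f => ?_⟩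
  rw [Set.forall_mem_insert, h.2]
  constructor
  · rintro ⟨h1, g, rfl⟩
    rw [leftEval_mul a _ _ _ hc, mul_eq_zero, or_iff_right ha, leftEval_eq_zero_iff] at h1
    obtain ⟨g', rfl⟩ := h1
    exact ⟨g', (mul_assoc _ _ _).symm⟩
  · rintro ⟨g, rfl⟩
    refine ⟨?_, _, mul_assoc _ _ _⟩
    rw [mul_assoc, leftEval_mul a _ _ _ hc, (leftEval_eq_zero_iff _ _).2 ⟨g, rfl⟩, mul_zero]

theorem IsRightMin.insert {S : Set ℍ[ℝ]} {P : ℍ[ℝ][X]} (h : IsRightMin S P) {a : ℍ[ℝ]}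
    (ha : rightEval a P ≠ 0) :
    IsRightMin (insert a S) ((X - C (rightEval a P * a * (rightEval a P)⁻¹)) * P) := by
  have hc : rightEval a P * a = (rightEval a P * a * (rightEval a P)⁻¹) * rightEval a P := by
    rw [inv_mul_cancel_right₀ ha]
  refine ⟨(monic_X_sub_C _).mul h.1, fun f => ?_⟩
  rw [Set.forall_mem_insert, h.2]
  constructor
  · rintro ⟨h1, g, rfl⟩
    rw [rightEval_mul a _ _ _ hc, mul_eq_zero, or_iff_left ha, rightEval_eq_zero_iff] at h1
    obtain ⟨g', rfl⟩ := h1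
    exact ⟨g', by rw [mul_assoc]⟩
  · rintro ⟨g, rfl⟩
    refine ⟨?_, _, (mul_assoc _ _ _).symm⟩
    rw [← mul_assoc, rightEval_mul a _ _ _ hc, (rightEval_eq_zero_iff _ _).2 ⟨g, rfl⟩, zero_mul]

theorem IsLeftMin.leftEval_eq_zero {S : Set ℍ[ℝ]} {P : ℍ[ℝ][X]} (h : IsLeftMin S P) {a : ℍ[ℝ]}
    (ha : a ∈ S) : leftEval a P = 0 :=
  (h.2 P).2 ⟨1, (mul_one P).symm⟩ a ha

theorem IsRightMin.rightEval_eq_zero {S : Set ℍ[ℝ]} {P : ℍ[ℝ][X]} (h : IsRightMin S P) {a : ℍ[ℝ]}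
    (ha : a ∈ S) : rightEval a P = 0 :=
  (h.2 P).2 ⟨1, (one_mul P).symm⟩ a ha

theorem rightEval_norm (b : ℍ[ℝ]) (P : ℍ[ℝ][X]) :
    rightEval b (conjPoly P * P) = leftEval b (conjPoly P * P) :=
  (leftEval_eq_rightEval_of_conjPoly_eq (conjPoly_conjPoly_mul_self P) b).symm

theorem rightEval_X_sub_C_mul_C (a b x : ℍ[ℝ]) :
    rightEval b ((X - C a) * C x) = x * b - a * x := by
  rw [sub_mul, rightEval_sub, X_mul, rightEval_C_mul, rightEval_X, ← C_mul, rightEval_C]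

theorem commute_star_of_commute {a u : ℍ[ℝ]} (h : Commute a u) : Commute (star a) u := by
  rw [Quaternion.star_eq_two_re_sub]
  exact Commute.sub_left (Quaternion.coe_commutes _ _) h

/-- A solution of the Sylvester equation `a x - x b = y`. -/
theorem mul_sub_mul_eq_of_star_mul_eq {a b y : ℍ[ℝ]} (ha : a.im ≠ 0)
    (h : star a * y = y * b) :
    a * ((2 * a.im)⁻¹ * y) - (2 * a.im)⁻¹ * y * b = y := by
  have hm : 2 * a.im = a - star a := by
    ext <;> simp [two_mul]
  have h0 : a - star a ≠ 0 := by
    rw [← hm]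
    rw [two_mul, ← two_smul ℝ]
    exact smul_ne_zero two_ne_zero ha
  have hc : Commute a (a - star a)⁻¹ :=
    ((Commute.refl a).sub_right (commute_star_of_commute (Commute.refl a)).symm).inv_right₀
  -- As `a - ā` commutes with `a`, its inverse factors out on the left, leaving `a y - y b = (a - ā)
  -- y`.
  rw [hm, ← mul_assoc, hc.eq, mul_assoc, mul_assoc, ← h, ← mul_sub, ← sub_mul,
    inv_mul_cancel_left₀ h0]

/-! ### One equivalent pair of nodes -/

section Pair

variable {P Q : ℍ[ℝ][X]} {a b : ℍ[ℝ]}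

/-- Lets a polynomial middle factor be replaced by a constant, namely its value at the twisted node;
this is how α̃ enters. -/
theorem leftEval_mul_mul_eq (hP : leftEval a P ≠ 0) (G : ℍ[ℝ][X]) :
    leftEval a (P * G * Q) =
      leftEval a (P * C (leftEval ((leftEval a P)⁻¹ * a * leftEval a P) G) * Q) := by
  have hc : a * leftEval a P = leftEval a P * ((leftEval a P)⁻¹ * a * leftEval a P) := by
    rw [mul_assoc, mul_inv_cancel_left₀ hP]
  rw [mul_assoc, mul_assoc, leftEval_mul a _ _ _ hc, leftEval_mul a _ _ _ hc, leftEval_mul_eq]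

theorem rightEval_mul_mul_eq (hQ : rightEval b Q ≠ 0) (G : ℍ[ℝ][X]) :
    rightEval b (P * G * Q) =
      rightEval b (P * C (rightEval (rightEval b Q * b * (rightEval b Q)⁻¹) G) * Q) := by
  have hc : rightEval b Q * b = (rightEval b Q * b * (rightEval b Q)⁻¹) * rightEval b Q := by
    rw [inv_mul_cancel_right₀ hQ]
  rw [rightEval_mul b _ _ _ hc, rightEval_mul b _ _ _ hc, rightEval_mul_eq]

theorem leftEval_mul_C_mul_injective (hP : leftEval a P ≠ 0)
    (hQ : leftEval a (conjPoly Q * Q) ≠ 0) {x y : ℍ[ℝ]}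
    (h : leftEval a (P * C x * Q) = leftEval a (P * C y * Q)) : x = y := by
  rw [leftEval_mul_eq, leftEval_mul_eq a (P * C y), leftEval_mul_C, leftEval_mul_C,
    ← sub_eq_zero, ← leftEval_sub, ← sub_mul, ← C_sub, ← mul_sub] at h
  have h1 := leftEval_C_mul_cancel hQ h
  rwa [mul_eq_zero, or_iff_right hP, sub_eq_zero] at h1

theorem rightEval_mul_C_mul_injective (hP : leftEval b (conjPoly P * P) ≠ 0)
    (hQ : rightEval b Q ≠ 0) {x y : ℍ[ℝ]}
    (h : rightEval b (P * C x * Q) = rightEval b (P * C y * Q)) : x = y := by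
  rw [← rightEval_norm] at hP
  exact ((eq_gammaCoeff_iff hP hQ _ x).1 h).trans ((eq_gammaCoeff_iff hP hQ _ y).1 rfl).symm

/-- The prescribed values satisfy the Sylvester solvability condition after passing to the
coefficients `ρ` and `γ`. -/
theorem star_mul_rhoCoeff_sub_gammaCoeff (hab : IsConj a b) (hP : leftEval a P ≠ 0)
    (hQ : rightEval b Q ≠ 0) (hPa : leftEval a (conjPoly P * P) ≠ 0)
    (hPb : leftEval b (conjPoly P * P) ≠ 0) (hQa : leftEval a (conjPoly Q * Q) ≠ 0)
    {c d q : ℍ[ℝ]} (hq : a * q - q * b = c - d) :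
    star ((leftEval a P)⁻¹ * a * leftEval a P) * (rhoCoeff P Q a c - gammaCoeff P Q b d) =
      (rhoCoeff P Q a c - gammaCoeff P Q b d) *
        (rightEval b Q * b * (rightEval b Q)⁻¹) := by
  set ρ := rhoCoeff P Q a c with hρ
  set γ := gammaCoeff P Q b d with hγ
  set p := leftEval a P with hp
  set r := rightEval b Q with hr
  set a' := p⁻¹ * a * p with ha'
  set b' := r * b * r⁻¹ with hb'
  have hab' : IsConj a' b' :=
    (isConj_inv_mul_mul a hP).trans (hab.trans (isConj_mul_mul_inv b hQ))
  set N := (conjPoly P * P) * (conjPoly Q * Q) with hN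
  have hNP := conjPoly_conjPoly_mul_self P
  have hNQ := conjPoly_conjPoly_mul_self Q
  have hNc : conjPoly N = N := by
    rw [hN, conjPoly_mul, hNP, hNQ, mul_comm_of_conjPoly_eq hNP]
  -- A linear polynomial with leading coefficient `q` has both values, since they differ by `a q - q
  -- b = c - d`.
  obtain ⟨F, hFa, hFb⟩ : ∃ F : ℍ[ℝ][X], leftEval a F = c ∧ rightEval b F = d := by
    refine ⟨C (c - a * q) + X * C q, ?_, ?_⟩
    · rw [leftEval_add, leftEval_C, leftEval_mul_C, leftEval_X, sub_add_cancel]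
    · rw [rightEval_add, rightEval_C, X_mul, rightEval_C_mul, rightEval_X, sub_add, hq,
        sub_sub_cancel]
  -- Chosen so that `P G Q` is `F` times the central `N`: up to values of `N`, the twisted values of
  -- `G` are then ρ and γ.
  set G := conjPoly P * F * conjPoly Q with hG
  have hPGQ : P * G * Q = N * F := by
    rw [hG, hN, mul_assoc (conjPoly P * P), mul_comm_of_conjPoly_eq hNQ, ← mul_conjPoly_self P]
    simp only [mul_assoc]
  have hGa : leftEval a' G = leftEval a' N * ρ := by
    apply leftEval_mul_C_mul_injective hP hQa
    rw [← leftEval_mul_C, ← leftEval_mul_mul_eq hP, ← leftEval_mul_mul_eq hP, hPGQ,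
      ← mul_assoc P, ← mul_comm_of_conjPoly_eq hNc P, mul_assoc N, mul_assoc N,
      leftEval_mul_of_conjPoly_eq hNc, leftEval_mul_of_conjPoly_eq hNc,
      leftEval_mul_rhoCoeff_mul hP hQa, hFa]
  have hGb : rightEval b' G = γ * rightEval b' N := by
    apply rightEval_mul_C_mul_injective hPb hQ
    rw [← rightEval_C_mul, ← rightEval_mul_mul_eq hQ, ← rightEval_mul_mul_eq hQ, hPGQ, mul_comm_of_conjPoly_eq hNc,
      ← mul_assoc P, mul_assoc _ N Q, mul_comm_of_conjPoly_eq hNc Q, ← mul_assoc (P * C γ),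
      rightEval_mul_of_conjPoly_eq hNc, rightEval_mul_of_conjPoly_eq hNc,
      rightEval_mul_gammaCoeff_mul (by rwa [rightEval_norm]) hQ, hFb]
  have h1 := leftEval_sub_rightEval a' b' G
  have h2 := leftEval_sub_rightEval a' b' (N * C γ)
  rw [leftEval_mul_C, mul_comm_of_conjPoly_eq hNc, rightEval_C_mul] at h2
  rw [hGa, hGb] at h1
  -- Subtracting the difference identity for `N γ` from that for `G` puts `N(a') (ρ - γ)` in the
  -- image of the Sylvester operator of `(a', b')`. As `N(a')` commutes with `star a'`, it can be
  -- cancelled from the image condition once it is known to be nonzero.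
  set t1 := rightEval b' (leftShift a' G)
  set t2 := rightEval b' (leftShift a' (C γ * N))
  have h3 : leftEval a' N * (ρ - γ) = a' * (t1 - t2) - (t1 - t2) * b' := by
    calc leftEval a' N * (ρ - γ) = (leftEval a' N * ρ - γ * rightEval b' N) -
          (leftEval a' N * γ - γ * rightEval b' N) := by noncomm_ring
      _ = _ := by rw [h1, h2]; noncomm_ring
  have h4 := star_mul_sub_eq hab' (t1 - t2)
  rw [← h3] at h4
  have hn0 : leftEval a' N ≠ 0 := by
    have hNa : leftEval a N ≠ 0 := by
      rw [hN, leftEval_mul_of_conjPoly_eq hNP]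
      exact mul_ne_zero hPa hQa
    have e : leftEval a N * p = p * leftEval a' N := by
      rw [← leftEval_mul_C, mul_comm_of_conjPoly_eq hNc,
        leftEval_mul a a' _ _ (by rw [leftEval_C, ha', mul_assoc, mul_inv_cancel_left₀ hP]),
        leftEval_C]
    intro h0
    rw [h0, mul_zero] at e
    exact mul_ne_zero hNa hP e
  rw [← mul_assoc, (commute_star_of_commute (commute_leftEval_of_conjPoly_eq hNc a')).eq,
    mul_assoc, mul_assoc] at h4
  exact mul_left_cancel₀ hn0 h4

/-- Right vanishing of `P (z - a') x Q` at `b` means that `x` intertwines the conjugated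
nodes. -/
theorem mul_eq_mul_of_rightEval_eq_zero (hPb : leftEval b (conjPoly P * P) ≠ 0)
    (hQ : rightEval b Q ≠ 0) {a' x : ℍ[ℝ]}
    (h : rightEval b (P * (X - C a') * C x * Q) = 0) :
    a' * x = x * (rightEval b Q * b * (rightEval b Q)⁻¹) := by
  rw [mul_assoc P, rightEval_mul_mul_eq hQ, rightEval_X_sub_C_mul_C] at h
  have h0 : rightEval b (P * C 0 * Q) = 0 := by
    rw [C_0, mul_zero, zero_mul, rightEval_zero]
  exact (sub_eq_zero.1 (rightEval_mul_C_mul_injective hPb hQ (h.trans h0.symm))).symm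

/-- Writing `x` for the second coefficient and `b'` for the twist of `b`, the middle factor `ρ + (z
- a') x` has right value `ρ - (a' x - x b')` at `b'`, and `x` is the solution of `a' x - x b' = ρ -
γ`. -/
theorem rightEval_pair (hab : IsConj a b) (hb : b.im ≠ 0) (hP : leftEval a P ≠ 0)
    (hQ : rightEval b Q ≠ 0) (hPa : leftEval a (conjPoly P * P) ≠ 0)
    (hPb : leftEval b (conjPoly P * P) ≠ 0) (hQa : leftEval a (conjPoly Q * Q) ≠ 0)
    {c d q a' : ℍ[ℝ]} (ha' : a' = (leftEval a P)⁻¹ * a * leftEval a P)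
    (hq : a * q - q * b = c - d) :
    rightEval b (P * C (rhoCoeff P Q a c) * Q + P * (X - C a') *
      C ((2 * a'.im)⁻¹ * (rhoCoeff P Q a c - gammaCoeff P Q b d)) * Q) = d := by
  have h := star_mul_rhoCoeff_sub_gammaCoeff hab hP hQ hPa hPb hQa hq
  rw [← ha'] at h
  have hc : IsConj a' b := ha' ▸ (isConj_inv_mul_mul a hP).trans hab
  have h1 := mul_sub_mul_eq_of_star_mul_eq (im_ne_zero_of_isConj hc hb) h
  rw [← add_mul, mul_assoc P, ← mul_add, rightEval_mul_mul_eq hQ, rightEval_add, rightEval_C,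
    rightEval_X_sub_C_mul_C, ← neg_sub (a' * _), h1, neg_sub, add_sub_cancel,
    rightEval_mul_gammaCoeff_mul (by rwa [rightEval_norm]) hQ]

/-- The shift `L_a` of `P (z - P(a)⁻¹ a P(a))` has the same norm polynomial as `P`. -/
theorem norm_leftShift (hP : leftEval a P ≠ 0) {a' : ℍ[ℝ]}
    (ha' : a' = (leftEval a P)⁻¹ * a * leftEval a P) :
    conjPoly (leftShift a (P * (X - C a'))) * leftShift a (P * (X - C a')) = conjPoly P * P := by
  have hz : leftEval a (P * (X - C a')) = 0 := by
    rw [leftEval_mul a a' _ _ (by rw [ha', mul_assoc, mul_inv_cancel_left₀ hP]),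
      leftEval_X_sub_C, sub_self, mul_zero]
  -- Take norms in `(X - a) L = P (X - a')`. Since `P(a)` intertwines `X - a'` and `X - a`, these
  -- two have equal norms, which cancel.
  have h1 := conjPoly_mul_mul_mul (X - C a) (leftShift a (P * (X - C a')))
  rw [X_sub_C_mul_leftShift hz, conjPoly_mul_mul_mul] at h1
  have h2 : C (leftEval a P) * (X - C a') = (X - C a) * C (leftEval a P) := by
    rw [mul_sub, sub_mul, ← C_mul, ← C_mul, ha', mul_assoc, mul_inv_cancel_left₀ hP, X_mul]
  have h3 := conjPoly_mul_mul_mul (C (leftEval a P)) (X - C a')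
  rw [h2, conjPoly_mul_mul_mul,
    mul_comm_of_conjPoly_eq (conjPoly_conjPoly_mul_self (X - C a))] at h3
  have hp : C (leftEval a P) ≠ 0 := by rwa [Ne, C_eq_zero]
  have h4 := mul_left_cancel₀ (mul_ne_zero (conjPoly_ne_zero hp) hp) h3
  rw [← h4, mul_comm_of_conjPoly_eq (conjPoly_conjPoly_mul_self P)] at h1
  have hX := X_sub_C_ne_zero a
  exact (mul_left_cancel₀ (mul_ne_zero (conjPoly_ne_zero hX) hX) h1).symm

theorem rightEval_leftShift_eq_zero {g : ℍ[ℝ][X]} (hP : leftEval a P = 0)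
    (hQ : rightEval b Q = 0) : rightEval b (leftShift a (P * g * Q)) = 0 := by
  rw [mul_assoc, leftShift_mul hP, ← mul_assoc, rightEval_mul_of_eq_zero hQ]

end Pair

/-! ### Minimal polynomials of the node sets and sums over nodes -/

section Nodes

variable {n m : ℕ} (α : Fin n → ℍ[ℝ]) (β : Fin m → ℍ[ℝ])

theorem isLeftMin_PL : IsLeftMin (Set.range α) (PL α) := isLeftMin_leftMin (Set.finite_range α)

theorem isRightMin_PR : IsRightMin (Set.range β) (PR β) :=
  isRightMin_rightMin (Set.finite_range β)

theorem finite_range_diff (i : Fin n) : (Set.range α \ {α i}).Finite :=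
  (Set.finite_range α).subset Set.sdiff_subset

theorem isLeftMin_PLi (i : Fin n) : IsLeftMin (Set.range α \ {α i}) (PLi α i) :=
  isLeftMin_leftMin (finite_range_diff α i)

theorem isRightMin_PRj (j : Fin m) : IsRightMin (Set.range β \ {β j}) (PRj β j) :=
  isRightMin_rightMin (finite_range_diff β j)

theorem leftEval_PL (i : Fin n) : leftEval (α i) (PL α) = 0 :=
  (isLeftMin_PL α).leftEval_eq_zero ⟨i, rfl⟩

theorem rightEval_PR (j : Fin m) : rightEval (β j) (PR β) = 0 :=
  (isRightMin_PR β).rightEval_eq_zero ⟨j, rfl⟩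

variable {α β}

theorem leftEval_PLi (hα : Function.Injective α) {i t : Fin n} (h : t ≠ i) :
    leftEval (α t) (PLi α i) = 0 :=
  (isLeftMin_PLi α i).leftEval_eq_zero ⟨⟨t, rfl⟩, fun e => h (hα e)⟩

theorem rightEval_PRj (hβ : Function.Injective β) {j t : Fin m} (h : t ≠ j) :
    rightEval (β t) (PRj β j) = 0 :=
  (isRightMin_PRj β j).rightEval_eq_zero ⟨⟨t, rfl⟩, fun e => h (hβ e)⟩

theorem PL_eq {i : Fin n} (h : leftEval (α i) (PLi α i) ≠ 0) :
    PL α = PLi α i * (X - C (alphaTilde α i)) := by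
  have h1 := (isLeftMin_PLi α i).insert h
  rw [Set.insert_sdiff_singleton, Set.insert_eq_of_mem (Set.mem_range_self i)] at h1
  exact (isLeftMin_PL α).unique h1

theorem PR_eq {j : Fin m} (h : rightEval (β j) (PRj β j) ≠ 0) :
    PR β = (X - C (betaTilde β j)) * PRj β j := by
  have h1 := (isRightMin_PRj β j).insert h
  rw [Set.insert_sdiff_singleton, Set.insert_eq_of_mem (Set.mem_range_self j)] at h1
  exact (isRightMin_PR β).unique h1

/-- An intertwiner of α̃ and β̃ also intertwines `X - α̃` and `X - β̃`, so this linear factor moves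
across `x`. The μ-terms thus vanish at all left and all right nodes. -/
theorem PLi_mul_C_mul_PR_eq {i : Fin n} {j : Fin m} (hi : leftEval (α i) (PLi α i) ≠ 0)
    (hj : rightEval (β j) (PRj β j) ≠ 0) {x : ℍ[ℝ]}
    (h : alphaTilde α i * x = x * betaTilde β j) :
    PLi α i * C x * PR β = PL α * C x * PRj β j := by
  rw [PL_eq hi, PR_eq hj, mul_assoc _ (X - C _), sub_mul X _ (C x), ← C_mul, h, C_mul, X_mul, ← mul_sub]
  simp only [mul_assoc]

theorem exists_ne_forall_isConj_eq (hα : Function.Injective α)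
    (hA : ∀ x y z : Fin n, x ≠ y → x ≠ z → y ≠ z → ¬ (IsConj (α x) (α y) ∧ IsConj (α x) (α z)))
    (i : Fin n) : ∃ b, α i ≠ b ∧ ∀ x ∈ Set.range α \ {α i}, x ≠ b → ¬ IsConj x (α i) := by
  by_cases h : ∃ t, t ≠ i ∧ IsConj (α t) (α i)
  · obtain ⟨t, hti, ht⟩ := h
    refine ⟨α t, fun e => hti (hα e.symm), ?_⟩
    rintro _ ⟨⟨u, rfl⟩, hu⟩ hut hc
    exact hA i t u hti.symm (fun e => hu (by rw [e]; rfl)) (fun e => hut (by rw [e]))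
      ⟨ht.symm, hc.symm⟩
  · refine ⟨α i + 1, by simp, ?_⟩
    rintro _ ⟨⟨u, rfl⟩, hu⟩ - hc
    exact h ⟨u, fun e => hu (by rw [e]; rfl), hc⟩

theorem solution_eq_add {k : ℕ} (hkn : k ≤ n) (hkm : k ≤ m) (c : Fin n → ℍ[ℝ]) (d : Fin m → ℍ[ℝ])
    (μ : Fin k → ℍ[ℝ]) (h : ℍ[ℝ][X]) :
    solution α β hkn hkm c d μ h = solution α β hkn hkm c d μ 0 + PL α * h * PR β := by
  simp only [solution, mul_zero, zero_mul, add_zero]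

theorem sum_castLE_ite {k : ℕ} (hkn : k ≤ n) (i : Fin n) (x : ℍ[ℝ]) :
    (∑ s : Fin k, if s.castLE hkn = i then x else 0) = if i.val < k then x else 0 := by
  split_ifs with h
  · rw [Finset.sum_eq_single ⟨i.val, h⟩]
    · exact if_pos rfl
    · intro s _ hs
      exact if_neg fun e => hs (by subst e; rfl)
    · simp
  · refine Finset.sum_eq_zero fun s _ => if_neg fun e => h ?_
    rw [← e]
    exact s.isLt

/-- Each node is either unpaired or a member of one pair, so exactly one building block contributes
its value. -/
theorem sum_filter_add_sum_castLE {k : ℕ} (hkn : k ≤ n) (i : Fin n) (x : ℍ[ℝ]) :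
    (∑ t : Fin n with k ≤ t.val, if t = i then x else 0) +
      (∑ s : Fin k, if s.castLE hkn = i then x else 0) = x := by
  rw [sum_castLE_ite, Finset.sum_ite_eq']
  by_cases h : i.val < k
  · simp [h]
  · simp [h, not_lt.1 h]

end Nodes

end QuatInterp

/-! ### The interpolation theorem -/

theorem theoremT {n m k : ℕ} (hkn : k ≤ n) (hkm : k ≤ m)
    (α : Fin n → ℍ[ℝ]) (β : Fin m → ℍ[ℝ]) (c : Fin n → ℍ[ℝ]) (d : Fin m → ℍ[ℝ])
    -- distinct left nodes, distinct right nodes, no real right node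
    (hα : Function.Injective α) (hβ : Function.Injective β)
    (hβ_real : ∀ j, (β j).im ≠ 0)
    -- no three of the nodes `α₁, …, αₙ, β₁, …, βₘ` are equivalent
    (hA : ∀ x y z : Fin n ⊕ Fin m, x ≠ y → x ≠ z → y ≠ z →
      ¬ (IsConj (Sum.elim α β x) (Sum.elim α β y) ∧ IsConj (Sum.elim α β x) (Sum.elim α β z)))
    -- the equivalent pairs are `(αₛ, βₛ)` for `s ≤ k`
    (hpair : ∀ s : Fin k, IsConj (α (s.castLE hkn)) (β (s.castLE hkm)))
    (hleft : ∀ i : Fin n, k ≤ i.val → ∀ j, ¬ IsConj (α i) (β j))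
    (hright : ∀ j : Fin m, k ≤ j.val → ∀ i, ¬ IsConj (β j) (α i))
    -- the solvability conditions
    (hcd : ∀ s : Fin k,
      star (α (s.castLE hkn)) * (c (s.castLE hkn) - d (s.castLE hkm)) =
        (c (s.castLE hkn) - d (s.castLE hkm)) * β (s.castLE hkm))
    -- the additional prescribed values
    (q : Fin k → ℍ[ℝ])
    (hq : ∀ s : Fin k, α (s.castLE hkn) * q s - q s * β (s.castLE hkm) =
      c (s.castLE hkn) - d (s.castLE hkm)) :
    ∃ μ : Fin k → ℍ[ℝ],
      -- `μₛ` is given explicitly by `qₛ` and lies in the plane of `α̃ₛ`, `β̃ₛ`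
      (∀ s, μ s = muOf α β c d (s.castLE hkn) (s.castLE hkm) (q s)) ∧
      (∀ s, μ s ∈ plane (alphaTilde α (s.castLE hkn)) (betaTilde β (s.castLE hkm))) ∧
      -- `μₛ` is the only element of that plane that produces the value `qₛ`
      (∀ s, ∀ ν ∈ plane (alphaTilde α (s.castLE hkn)) (betaTilde β (s.castLE hkm)),
        (rightEval (β (s.castLE hkm)) (leftShift (α (s.castLE hkn))
          (fPair α β c d (s.castLE hkn) (s.castLE hkm) +
            PL α * Polynomial.C ν * PRj β (s.castLE hkm))) = q s ↔ ν = μ s)) ∧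
      -- the solutions are parametrized, without repetition, by `h`
      (∀ f : ℍ[ℝ][X],
        ((∀ i, leftEval (α i) f = c i) ∧ (∀ j, rightEval (β j) f = d j) ∧
          (∀ s : Fin k,
            rightEval (β (s.castLE hkm)) (leftShift (α (s.castLE hkn)) f) = q s)) ↔
        ∃! h : ℍ[ℝ][X], f = solution α β hkn hkm c d μ h) ∧
      -- no other choice of the parameters yields a solution
      (∀ ν : Fin k → ℍ[ℝ],
        (∀ s, ν s ∈ plane (alphaTilde α (s.castLE hkn)) (betaTilde β (s.castLE hkm))) →
        ∀ h : ℍ[ℝ][X],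
          (∀ s : Fin k, rightEval (β (s.castLE hkm)) (leftShift (α (s.castLE hkn))
            (solution α β hkn hkm c d ν h)) = q s) → ν = μ) := by
  have hA1 : ∀ x y z : Fin n, x ≠ y → x ≠ z → y ≠ z →
      ¬ (IsConj (α x) (α y) ∧ IsConj (α x) (α z)) := fun x y z h1 h2 h3 =>
    hA (.inl x) (.inl y) (.inl z) (by simpa using h1) (by simpa using h2) (by simpa using h3)
  have hA2 : ∀ x y z : Fin m, x ≠ y → x ≠ z → y ≠ z →
      ¬ (IsConj (β x) (β y) ∧ IsConj (β x) (β z)) := fun x y z h1 h2 h3 =>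
    hA (.inr x) (.inr y) (.inr z) (by simpa using h1) (by simpa using h2) (by simpa using h3)
  have hPLi : ∀ i, leftEval (α i) (PLi α i) ≠ 0 := fun i => by
    obtain ⟨b, hb, h⟩ := exists_ne_forall_isConj_eq hα hA1 i
    exact (isLeftMin_PLi α i).leftEval_ne_zero (finite_range_diff α i) hb h
  have hPRj : ∀ j, rightEval (β j) (PRj β j) ≠ 0 := fun j => by
    obtain ⟨b, hb, h⟩ := exists_ne_forall_isConj_eq hβ hA2 j
    exact (isRightMin_PRj β j).rightEval_ne_zero (finite_range_diff β j) hb h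
  have hNPL : ∀ j : Fin m, k ≤ j.val → leftEval (β j) (conjPoly (PL α) * PL α) ≠ 0 :=
    fun j hj => (isLeftMin_PL α).norm_ne_zero (Set.finite_range α) (by
      rintro _ ⟨i, rfl⟩ h
      exact hright j hj i h.symm)
  have hNPR : ∀ i : Fin n, k ≤ i.val → leftEval (α i) (conjPoly (PR β) * PR β) ≠ 0 :=
    fun i hi => (isRightMin_PR β).norm_ne_zero (Set.finite_range β) (by
      rintro _ ⟨j, rfl⟩ h
      exact hleft i hi j h.symm)
  -- A further left node equivalent to `αₛ` would make three equivalent nodes together with `βₛ`.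
  have hAα : ∀ s : Fin k, ∀ x ∈ Set.range α \ {α (s.castLE hkn)},
      ¬ IsConj x (α (s.castLE hkn)) := by
    rintro s _ ⟨⟨t, rfl⟩, ht⟩ h
    refine hA (.inl (s.castLE hkn)) (.inl t) (.inr (s.castLE hkm)) ?_ (by simp) (by simp)
      ⟨h.symm, hpair s⟩
    intro e
    exact ht (by rw [Sum.inl.inj e]; rfl)
  have hAβ : ∀ s : Fin k, ∀ x ∈ Set.range β \ {β (s.castLE hkm)},
      ¬ IsConj x (β (s.castLE hkm)) := by
    rintro s _ ⟨⟨t, rfl⟩, ht⟩ h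
    refine hA (.inr (s.castLE hkm)) (.inr t) (.inl (s.castLE hkn)) ?_ (by simp) (by simp)
      ⟨h.symm, (hpair s).symm⟩
    intro e
    exact ht (by rw [Sum.inr.inj e]; rfl)
  have hPa : ∀ s : Fin k, leftEval (α (s.castLE hkn))
      (conjPoly (PLi α (s.castLE hkn)) * PLi α (s.castLE hkn)) ≠ 0 := fun s =>
    (isLeftMin_PLi α _).norm_ne_zero (finite_range_diff α _) (hAα s)
  have hPb : ∀ s : Fin k, leftEval (β (s.castLE hkm))
      (conjPoly (PLi α (s.castLE hkn)) * PLi α (s.castLE hkn)) ≠ 0 := fun s =>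
    (isLeftMin_PLi α _).norm_ne_zero (finite_range_diff α _)
      fun x hx h => hAα s x hx (h.trans (hpair s).symm)
  have hQa : ∀ s : Fin k, leftEval (α (s.castLE hkn))
      (conjPoly (PRj β (s.castLE hkm)) * PRj β (s.castLE hkm)) ≠ 0 := fun s =>
    (isRightMin_PRj β _).norm_ne_zero (finite_range_diff β _)
      fun x hx h => hAβ s x hx (h.trans (hpair s))
  have hNA : ∀ s : Fin k, rightEval (β (s.castLE hkm))
      (conjPoly (leftShift (α (s.castLE hkn)) (PL α)) *
        leftShift (α (s.castLE hkn)) (PL α)) ≠ 0 := fun s => by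
    rw [rightEval_norm, PL_eq (hPLi (s.castLE hkn)), norm_leftShift (hPLi (s.castLE hkn)) (a' := alphaTilde α (s.castLE hkn)) rfl]
    exact hPb s
  -- values of the building blocks
  have hpl : ∀ (i : Fin n) (s : Fin k), leftEval (α i)
      (fPair α β c d (s.castLE hkn) (s.castLE hkm)) = if s.castLE hkn = i then c i else 0 := by
    intro i s
    rw [fPair, leftEval_add, mul_assoc (PL α), leftEval_mul_of_eq_zero (leftEval_PL α i), add_zero]
    split_ifs with h
    · rw [← h, leftEval_mul_rhoCoeff_mul (hPLi _) (hQa s)]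
    · rw [mul_assoc, leftEval_mul_of_eq_zero (leftEval_PLi hα (Ne.symm h))]
  have hpr : ∀ (j : Fin m) (s : Fin k), rightEval (β j)
      (fPair α β c d (s.castLE hkn) (s.castLE hkm)) = if s.castLE hkm = j then d j else 0 := by
    intro j s
    split_ifs with h
    · rw [← h, fPair, PL_eq (hPLi (s.castLE hkn))]
      exact rightEval_pair (hpair s) (hβ_real _) (hPLi _) (hPRj _) (hPa s) (hPb s) (hQa s) rfl
        (hq s)
    · rw [fPair, ← add_mul, rightEval_mul_of_eq_zero (rightEval_PRj hβ (Ne.symm h))]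
  have hplane : ∀ (s : Fin k) (ν : ℍ[ℝ]),
      ν ∈ plane (alphaTilde α (s.castLE hkn)) (betaTilde β (s.castLE hkm)) ↔
        alphaTilde α (s.castLE hkn) * ν = ν * betaTilde β (s.castLE hkm) := fun s ν => by
    have hbb := isConj_mul_mul_inv (β (s.castLE hkm)) (hPRj (s.castLE hkm))
    exact mem_plane_iff ((isConj_inv_mul_mul _ (hPLi _)).trans ((hpair s).trans hbb))
      (im_ne_zero_of_isConj hbb.symm (hβ_real _)) ν
  -- The shift condition is a one-point problem for ν with `L_{αₛ} P_Λ` as first factor; its unique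
  -- solution needs no membership in the plane.
  have hshift : ∀ (s : Fin k) (ν : ℍ[ℝ]),
      rightEval (β (s.castLE hkm)) (leftShift (α (s.castLE hkn))
          (fPair α β c d (s.castLE hkn) (s.castLE hkm) +
            PL α * C ν * PRj β (s.castLE hkm))) = q s ↔
        ν = muOf α β c d (s.castLE hkn) (s.castLE hkm) (q s) := fun s ν => by
    rw [leftShift_add, rightEval_add, mul_assoc, leftShift_mul (leftEval_PL α _), ← mul_assoc,
      ← eq_sub_iff_add_eq', eq_gammaCoeff_iff (hNA s) (hPRj _)]
    rfl
  set μ : Fin k → ℍ[ℝ] := fun s => muOf α β c d (s.castLE hkn) (s.castLE hkm) (q s) with hμ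
  -- With left value `cₛ` and shift value `qₛ`, the corrected block has right value `cₛ - (αₛ qₛ -
  -- qₛ βₛ) = dₛ`. The pair block alone already has this value, so the correction vanishes at `βₛ`,
  -- which forces `μₛ` to intertwine.
  have hμc : ∀ s : Fin k, alphaTilde α (s.castLE hkn) * μ s =
      μ s * betaTilde β (s.castLE hkm) := by
    intro s
    apply mul_eq_mul_of_rightEval_eq_zero (hPb s) (hPRj _)
    rw [← PL_eq (hPLi _)]
    have h1 := leftEval_sub_rightEval (α (s.castLE hkn)) (β (s.castLE hkm))
      (fPair α β c d (s.castLE hkn) (s.castLE hkm) + PL α * C (μ s) * PRj β (s.castLE hkm))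
    rw [(hshift s (μ s)).2 rfl, hq, leftEval_add, rightEval_add, hpl, hpr, if_pos rfl, if_pos rfl,
      mul_assoc, leftEval_mul_of_eq_zero (leftEval_PL α _), add_zero, sub_add_eq_sub_sub,
      sub_eq_self] at h1
    rw [mul_assoc]
    exact h1
  have hmid : ∀ (s : Fin k) (ν : ℍ[ℝ]), alphaTilde α (s.castLE hkn) * ν =
      ν * betaTilde β (s.castLE hkm) → PLi α (s.castLE hkn) * C ν * PR β =
        PL α * C ν * PRj β (s.castLE hkm) := fun s ν h =>
    PLi_mul_C_mul_PR_eq (hPLi _) (hPRj _) h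
  have hsl : ∀ h i, leftEval (α i) (solution α β hkn hkm c d μ h) = c i := by
    intro h i
    have h1 : ∀ t ∈ Finset.univ.filter (fun t : Fin n => k ≤ t.val),
        leftEval (α i) (fLeft α β c t) = if t = i then c i else 0 := by
      intro t ht
      rw [fLeft]
      split_ifs with e
      · rw [← e, leftEval_mul_rhoCoeff_mul (hPLi _) (hNPR t (Finset.mem_filter.1 ht).2)]
      · rw [mul_assoc, leftEval_mul_of_eq_zero (leftEval_PLi hα (Ne.symm e))]
    have h2 : ∑ j : Fin m with k ≤ j.val, leftEval (α i) (fRight α β d j) = 0 :=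
      Finset.sum_eq_zero fun j _ => by
        rw [fRight, mul_assoc, leftEval_mul_of_eq_zero (leftEval_PL α i)]
    have h3 : ∑ s : Fin k, leftEval (α i) (PLi α (s.castLE hkn) * C (μ s) * PR β) = 0 :=
      Finset.sum_eq_zero fun s _ => by
        rw [hmid s _ (hμc s), mul_assoc, leftEval_mul_of_eq_zero (leftEval_PL α i)]
    simp only [solution, leftEval_add, leftEval_sum]
    rw [Finset.sum_congr rfl h1, Finset.sum_congr rfl fun s _ => hpl i s, h2, h3, mul_assoc,
      leftEval_mul_of_eq_zero (leftEval_PL α i), add_zero, add_zero, add_zero,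
      sum_filter_add_sum_castLE]
  have hsr : ∀ h j, rightEval (β j) (solution α β hkn hkm c d μ h) = d j := by
    intro h j
    have h1 : ∀ t ∈ Finset.univ.filter (fun t : Fin m => k ≤ t.val),
        rightEval (β j) (fRight α β d t) = if t = j then d j else 0 := by
      intro t ht
      rw [fRight]
      split_ifs with e
      · rw [← e, rightEval_mul_gammaCoeff_mul _ (hPRj _)]
        rw [rightEval_norm]
        exact hNPL t (Finset.mem_filter.1 ht).2
      · rw [rightEval_mul_of_eq_zero (rightEval_PRj hβ (Ne.symm e))]
    have h2 : ∑ i : Fin n with k ≤ i.val, rightEval (β j) (fLeft α β c i) = 0 :=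
      Finset.sum_eq_zero fun i _ => by
        rw [fLeft, rightEval_mul_of_eq_zero (rightEval_PR β j)]
    have h3 : ∑ s : Fin k, rightEval (β j) (PLi α (s.castLE hkn) * C (μ s) * PR β) = 0 :=
      Finset.sum_eq_zero fun s _ => rightEval_mul_of_eq_zero (rightEval_PR β j) _
    simp only [solution, rightEval_add, rightEval_sum]
    rw [Finset.sum_congr rfl h1, Finset.sum_congr rfl fun s _ => hpr j s, h2, h3,
      rightEval_mul_of_eq_zero (rightEval_PR β j), add_zero, add_zero, zero_add,
      sum_filter_add_sum_castLE]
  -- Every other term has a left factor vanishing at `αₛ` and a right factor vanishing at `βₛ`, so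
  -- its shift contributes nothing.
  have hss : ∀ (ν : Fin k → ℍ[ℝ]), (∀ s, alphaTilde α (s.castLE hkn) * ν s =
      ν s * betaTilde β (s.castLE hkm)) → ∀ h s, rightEval (β (s.castLE hkm))
        (leftShift (α (s.castLE hkn)) (solution α β hkn hkm c d ν h)) =
      rightEval (β (s.castLE hkm)) (leftShift (α (s.castLE hkn))
          (fPair α β c d (s.castLE hkn) (s.castLE hkm) +
            PL α * C (ν s) * PRj β (s.castLE hkm))) := by
    intro ν hν h s
    have hne : ∀ t : Fin k, t ≠ s → s.castLE hkn ≠ t.castLE hkn ∧ s.castLE hkm ≠ t.castLE hkm :=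
      fun t ht => ⟨fun e => ht (Fin.castLE_injective hkn e).symm,
        fun e => ht (Fin.castLE_injective hkm e).symm⟩
    simp only [solution, leftShift_add, rightEval_add, leftShift_sum, rightEval_sum]
    rw [Finset.sum_eq_zero (s := Finset.univ.filter fun i : Fin n => k ≤ i.val) fun i hi => ?_,
      Finset.sum_eq_zero (s := Finset.univ.filter fun j : Fin m => k ≤ j.val) fun j hj => ?_,
      Finset.sum_eq_single s ?_ (by simp), Finset.sum_eq_single s ?_ (by simp),
      rightEval_leftShift_eq_zero (leftEval_PL α _) (rightEval_PR β _), hmid s _ (hν s), add_zero,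
      add_zero, zero_add]
    · intro t _ ht
      exact rightEval_leftShift_eq_zero (leftEval_PLi hα (hne t ht).1) (rightEval_PR β _)
    · intro t _ ht
      rw [fPair, leftShift_add, rightEval_add,
        rightEval_leftShift_eq_zero (leftEval_PLi hα (hne t ht).1)
          (rightEval_PRj hβ (hne t ht).2),
        rightEval_leftShift_eq_zero (leftEval_PL α _) (rightEval_PRj hβ (hne t ht).2), add_zero]
    · refine rightEval_leftShift_eq_zero (leftEval_PL α _) (rightEval_PRj hβ fun e => ?_)
      have h1 := (Finset.mem_filter.1 hj).2
      rw [← e] at h1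
      exact absurd s.isLt (not_lt.2 h1)
    · refine rightEval_leftShift_eq_zero (leftEval_PLi hα fun e => ?_) (rightEval_PR β _)
      have h1 := (Finset.mem_filter.1 hi).2
      rw [← e] at h1
      exact absurd s.isLt (not_lt.2 h1)
  have hsq : ∀ h s, rightEval (β (s.castLE hkm))
      (leftShift (α (s.castLE hkn)) (solution α β hkn hkm c d μ h)) = q s := fun h s => by
    rw [hss μ hμc, (hshift s _).2 rfl]
  refine ⟨μ, fun s => rfl, fun s => (hplane s _).2 (hμc s), fun s ν _ => hshift s ν, fun f => ?_,
    fun ν hν h hνq => ?_⟩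
  · constructor
    · rintro ⟨hfl, hfr, hfs⟩
      set g := f - solution α β hkn hkm c d μ 0 with hg
      obtain ⟨G, hG⟩ := ((isLeftMin_PL α).2 g).1 (by
        rintro _ ⟨i, rfl⟩
        rw [hg, leftEval_sub, hfl, hsl, sub_self])
      obtain ⟨h, hh⟩ := ((isRightMin_PR β).2 G).1 (by
        rintro _ ⟨j, rfl⟩
        by_cases hj : k ≤ j.val
        · apply rightEval_mul_cancel (P := PL α)
          · rw [rightEval_norm]
            exact hNPL j hj
          · rw [← hG, hg, rightEval_sub, hfr, hsr, sub_self]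
        -- At a paired node the argument through the norm of `P_Λ` is not available, so `L_{αₛ} P_Λ`
        -- is cancelled instead of `P_Λ`, using the shift condition.
        · obtain ⟨s, rfl⟩ : ∃ s : Fin k, s.castLE hkm = j := ⟨⟨j.val, not_le.1 hj⟩, rfl⟩
          apply rightEval_mul_cancel (hNA s)
          rw [← leftShift_mul (leftEval_PL α _), ← hG, hg, leftShift_sub, rightEval_sub, hfs, hsq,
            sub_self])
      have hf : f = solution α β hkn hkm c d μ h := by
        rw [solution_eq_add, mul_assoc, ← hh, ← hG, hg, add_sub_cancel]
      refine ⟨h, hf, fun h' hf' => ?_⟩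
      rw [hf, solution_eq_add, solution_eq_add (h := h')] at hf'
      exact (mul_left_cancel₀ (isLeftMin_PL α).1.ne_zero
        (mul_right_cancel₀ (isRightMin_PR β).1.ne_zero (add_left_cancel hf'))).symm
    · rintro ⟨h, rfl, -⟩
      exact ⟨hsl h, hsr h, hsq h⟩
  · funext s
    exact (hshift s (ν s)).1 ((hss ν (fun s => (hplane s _).1 (hν s)) h s).symm.trans (hνq s))
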